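/- **Theorem 1.2.** Let $\mathcal M$ be a von Neumann algebra on a complex Hilbert space $H$ and let $\tau:\mathcal M\to\mathbb C$ be a faithful normal tracial state. Let $\mathcal A$ be the algebra of closed, densely defined linear operators on $H$ affiliated with $\mathcal M$, where sum, product and scalar multiple are the closures of the operator sum, composition and scalar multiple on their natural domains; $\mathcal M\subseteq\mathcal A$. Let $n\ge 0$ and $X=(X_1,\dots,X_n)\in\mathcal M^n$ (not necessarily selfadjoint). For a matrix $P\in M_N(\mathbb C\langle x_1,\dots,x_n\rangle)$ of noncommutative polynomials let $P(X)\in M_N(\mathcal M)\subseteq M_N(\mathcal A)$ be its evaluation at $X$ (the entrywise unital homomorphism with $x_i\mapsto X_i$), and let $$\operatorname{rank}(P(X))=(\operatorname{Tr}_N\circ\tau^{(N)})\bigl(p_{\overline{\operatorname{im}P(X)}}\bigr),$$ where $p_{\overline{\operatorname{im}P(X)}}\in M_N(\mathcal M)$ is the orthogonal projection of $H^N$ onto the closure of the image of $P(X)$, $\tau^{(N)}$ applies $\tau$ to each entry and $\operatorname{Tr}_N$ is the unnormalized trace on $M_N(\mathbb C)$. Let $\mathbb C\langle X_1,\dots,X_n\rangle$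 be the unital algebra generated by $X_1,\dots,X_n$. Its *division closure* is the smallest subalgebra $\mathcal D$ of $\mathcal A$ that contains it and satisfies $d^{-1}\in\mathcal D$ whenever $d\in\mathcal D$ is invertible in $\mathcal A$. Its *rational closure* $\mathcal R$ is the set of all entries of $P(X)^{-1}$, over all $k\ge 1$ and all $P\in M_k(\mathbb C\langle x_1,\dots,x_n\rangle)$ for which $P(X)$ is invertible in $M_k(\mathcal A)$. For an $N\times N$ matrix $A$ over $\mathcal R$, the *inner rank* $\rho_{\mathcal R}(A)$ is the least $r\ge 0$ such that $A=BC$ with $B\in M_{N,r}(\mathcal R)$ and $C\in M_{r,N}(\mathcal R)$ (so $\rho_{\mathcal R}(A)=0$ exactly when $A=0$), and $A$ is *full over $\mathcal R$* if $\rho_{\mathcal R}(A)=N$. Then the following statements are equivalent. 1. $X$ has the strong Atiyah property: for every $N\in\mathbb N$ and every $P\in M_N(\mathbb C\langle x_1,\dots,x_n\rangle)$, $\operatorname{rank}(P(X))$ is a non-negative integer. 2. The division closure of $\mathbb C\langle X_1,\dots,X_n\rangle$ is a division ring. 3. The rational closure $\mathcal R$ of $\mathbb C\langle X_1,\dots,X_n\rangle$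 is a division ring. 4. For every $N\in\mathbb N$ and every $P\in M_N(\mathbb C\langle x_1,\dots,x_n\rangle)$: if $P(X)$ is full over $\mathcal R$, then $P(X)$ is invertible in $M_N(\mathcal A)$. 5. For every $N\in\mathbb N$ and every $P\in M_N(\mathbb C\langle x_1,\dots,x_n\rangle)$: $\operatorname{rank}(P(X))=\rho_{\mathcal R}(P(X))$. -/

import Mathlib

set_option linter.unusedSectionVars false

noncomputable section

namespace AtiyahProperty

variable {H : Type*} [NormedAddCommGroup H] [InnerProductSpace ℂ H] [CompleteSpace H]

/-! ### Tracial `W*`-probability spaces -/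

/-- `τ` is a faithful normal tracial state on the von Neumann algebra `M`. -/
structure IsTracialState (M : VonNeumannAlgebra H) (τ : M.toStarSubalgebra →ₗ[ℂ] ℂ) : Prop where
  map_one : τ 1 = 1
  nonneg : ∀ a, 0 ≤ (τ (star a * a)).re ∧ (τ (star a * a)).im = 0
  trace : ∀ a b, τ (a * b) = τ (b * a)
  faithful : ∀ a, τ (star a * a) = 0 → a = 0
  /-- `τ` preserves suprema of bounded increasing nets of positive operators
  (for the usual order of bounded operators). -/
  normal : ∀ (S : Set M.toStarSubalgebra) (a : M.toStarSubalgebra), S.Nonempty →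
    (∀ s ∈ S, (0 : H →L[ℂ] H) ≤ (s : H →L[ℂ] H)) →
    DirectedOn (fun s t : M.toStarSubalgebra => (s : H →L[ℂ] H) ≤ t) S →
    IsLUB ((fun s : M.toStarSubalgebra => (s : H →L[ℂ] H)) '' S) a →
    IsLUB ((fun s => (τ s).re) '' S) (τ a).re

/-! ### Affiliated operators and their algebraic operations

An unbounded operator on `H` is a partially defined linear map `H →ₗ.[ℂ] H`. -/

/-- The closed, densely defined operators `T` affiliated with `M`: every `b` in the commutant of
`M` maps the domain of `T` into itself and satisfies `T b x = b T x` there. -/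
def affiliated (M : VonNeumannAlgebra H) : Set (H →ₗ.[ℂ] H) :=
  {T | T.IsClosed ∧ Dense (T.domain : Set H) ∧
    ∀ b ∈ M.commutant, ∀ x : T.domain, ∃ h : b x ∈ T.domain, T ⟨b x, h⟩ = b (T x)}

/-- A bounded operator, viewed as an everywhere defined unbounded operator. -/
def ofBounded (a : H →L[ℂ] H) : H →ₗ.[ℂ] H :=
  (a : H →ₗ[ℂ] H).toPMap ⊤

/-- The composition of unbounded operators, on its natural domain
`{x ∈ dom T | T x ∈ dom S}`. -/
def pcomp (S T : H →ₗ.[ℂ] H) : H →ₗ.[ℂ] H where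
  domain := (S.domain.comap T.toFun).map T.domain.subtype
  toFun :=
    { toFun := fun x => S ⟨T ⟨x, by
          obtain ⟨y, -, hy⟩ := x.2; rw [← hy]; exact y.2⟩, by
          obtain ⟨x, y, hy, rfl⟩ := x; exact hy⟩
      map_add' := by
        intro x y
        rw [← S.map_add]
        congr 1
        exact Subtype.ext (T.map_add ⟨x, _⟩ ⟨y, _⟩)
      map_smul' := by
        intro c x
        rw [RingHom.id_apply, ← S.map_smul]
        congr 1
        exact Subtype.ext (T.map_smul c ⟨x, _⟩) }

/-- The sum in the algebra of affiliated operators: the closure of the sum defined on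
`dom S ∩ dom T`. -/
def sAdd (S T : H →ₗ.[ℂ] H) : H →ₗ.[ℂ] H := (S + T).closure

/-- The product in the algebra of affiliated operators: the closure of the composition. -/
def sMul (S T : H →ₗ.[ℂ] H) : H →ₗ.[ℂ] H := (pcomp S T).closure

/-- Scalar multiplication in the algebra of affiliated operators (the closure only matters for
`c = 0`). -/
def sSMul (c : ℂ) (T : H →ₗ.[ℂ] H) : H →ₗ.[ℂ] H := (c • T).closure

/-- The unit of the algebra of affiliated operators. -/
def sOne : H →ₗ.[ℂ] H := ofBounded 1

/-- `S` is the inverse of `T` with respect to the product of affiliated operators. -/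
def IsInverse (T S : H →ₗ.[ℂ] H) : Prop := sMul T S = sOne ∧ sMul S T = sOne

/-- `D` is a unital subalgebra of the algebra of operators affiliated with `M`. -/
structure IsSubalgebra (M : VonNeumannAlgebra H) (D : Set (H →ₗ.[ℂ] H)) : Prop where
  subset : D ⊆ affiliated M
  one_mem : sOne ∈ D
  add_mem : ∀ S ∈ D, ∀ T ∈ D, sAdd S T ∈ D
  mul_mem : ∀ S ∈ D, ∀ T ∈ D, sMul S T ∈ D
  smul_mem : ∀ c : ℂ, ∀ T ∈ D, sSMul c T ∈ D

/-- The set `D` of operators affiliated with `M` is a division ring under the operations of the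
algebra of affiliated operators. -/
def IsDivisionRing (M : VonNeumannAlgebra H) (D : Set (H →ₗ.[ℂ] H)) : Prop :=
  D ⊆ affiliated M ∧ ∃ _ : DivisionRing D,
    ((0 : D) : H →ₗ.[ℂ] H) = 0 ∧ ((1 : D) : H →ₗ.[ℂ] H) = sOne ∧
    (∀ S T : D, ((S + T : D) : H →ₗ.[ℂ] H) = sAdd S T) ∧
    (∀ S T : D, ((S * T : D) : H →ₗ.[ℂ] H) = sMul S T)

/-! ### Matrices over the affiliated operators -/

/-- The product of matrices of affiliated operators: the entry at `(i, j)` is the sum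
`A i 0 * B 0 j + (A i 1 * B 1 j + (⋯ + 0))` in the algebra of affiliated operators. -/
def matMul {l m n : ℕ} (A : Matrix (Fin l) (Fin m) (H →ₗ.[ℂ] H))
    (B : Matrix (Fin m) (Fin n) (H →ₗ.[ℂ] H)) : Matrix (Fin l) (Fin n) (H →ₗ.[ℂ] H) :=
  Matrix.of fun i j => (List.ofFn fun k => sMul (A i k) (B k j)).foldr sAdd 0

/-- The identity matrix over the affiliated operators. -/
def matOne (N : ℕ) : Matrix (Fin N) (Fin N) (H →ₗ.[ℂ] H) :=
  Matrix.of fun i j => if i = j then sOne else 0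

/-- All entries of the matrix `A` lie in `D`. -/
def EntriesIn {m n : ℕ} (D : Set (H →ₗ.[ℂ] H)) (A : Matrix (Fin m) (Fin n) (H →ₗ.[ℂ] H)) : Prop :=
  ∀ i j, A i j ∈ D

/-- `Q` is the inverse of `A` in the `N × N` matrices over the operators affiliated with `M`. -/
def IsMatInverse (M : VonNeumannAlgebra H) {N : ℕ} (A Q : Matrix (Fin N) (Fin N) (H →ₗ.[ℂ] H)) :
    Prop :=
  EntriesIn (affiliated M) Q ∧ matMul A Q = matOne N ∧ matMul Q A = matOne N

/-- The inner rank of `A` over `D`: the least `r` such that `A = P Q` with an `m × r` matrix `P`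
and an `r × n` matrix `Q` over `D`. The factorizations with `r = 0` are exactly those of the zero
matrix, whose inner rank is thus `0`. -/
def innerRank (D : Set (H →ₗ.[ℂ] H)) {m n : ℕ} (A : Matrix (Fin m) (Fin n) (H →ₗ.[ℂ] H)) : ℕ :=
  sInf {r | ∃ (P : Matrix (Fin m) (Fin r) (H →ₗ.[ℂ] H)) (Q : Matrix (Fin r) (Fin n) (H →ₗ.[ℂ] H)),
    EntriesIn D P ∧ EntriesIn D Q ∧ A = matMul P Q}

/-- A square matrix over `D` is full if its inner rank over `D` equals its size. -/
def IsFull (D : Set (H →ₗ.[ℂ] H)) {N : ℕ} (A : Matrix (Fin N) (Fin N) (H →ₗ.[ℂ] H)) : Prop :=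
  innerRank D A = N

/-! ### Evaluation of polynomials, division closure and rational closure -/

/-- The evaluation of a noncommutative polynomial at `X`, as an affiliated operator. -/
def ev {M : VonNeumannAlgebra H} {n : ℕ} (X : Fin n → M.toStarSubalgebra)
    (p : FreeAlgebra ℂ (Fin n)) : H →ₗ.[ℂ] H :=
  ofBounded (FreeAlgebra.lift ℂ X p : M.toStarSubalgebra)

/-- `P(X)` as a matrix over the affiliated operators. -/
def evMat {M : VonNeumannAlgebra H} {n N : ℕ} (X : Fin n → M.toStarSubalgebra)
    (P : Matrix (Fin N) (Fin N) (FreeAlgebra ℂ (Fin n))) : Matrix (Fin N) (Fin N) (H →ₗ.[ℂ] H) :=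
  P.map (ev X)

/-- The division closure of `ℂ⟨X₁, …, Xₙ⟩`: the smallest subalgebra of the affiliated operators
that contains `ℂ⟨X₁, …, Xₙ⟩` and is closed under taking inverses of affiliated operators. -/
def divisionClosure {M : VonNeumannAlgebra H} {n : ℕ} (X : Fin n → M.toStarSubalgebra) :
    Set (H →ₗ.[ℂ] H) :=
  ⋂₀ {D | IsSubalgebra M D ∧ Set.range (ev X) ⊆ D ∧
    ∀ T ∈ D, ∀ S ∈ affiliated M, IsInverse T S → S ∈ D}

/-- The rational closure of `ℂ⟨X₁, …, Xₙ⟩`: the set of all entries of inverses, over the affiliated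
operators, of matrices `P(X)` with `P` a square matrix of noncommutative polynomials. -/
def rationalClosure {M : VonNeumannAlgebra H} {n : ℕ} (X : Fin n → M.toStarSubalgebra) :
    Set (H →ₗ.[ℂ] H) :=
  {T | ∃ (k : ℕ) (P : Matrix (Fin k) (Fin k) (FreeAlgebra ℂ (Fin n)))
    (Q : Matrix (Fin k) (Fin k) (H →ₗ.[ℂ] H)), IsMatInverse M (evMat X P) Q ∧ ∃ i j, Q i j = T}

/-! ### The analytic rank of a matrix over `M` -/

/-- The bounded operator on `H^N` given by an `N × N` matrix over `M`. -/
def matOp {M : VonNeumannAlgebra H} {N : ℕ} (A : Matrix (Fin N) (Fin N) M.toStarSubalgebra) :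
    PiLp 2 (fun _ : Fin N => H) →L[ℂ] PiLp 2 (fun _ : Fin N => H) :=
  ((PiLp.continuousLinearEquiv 2 ℂ (fun _ : Fin N => H)).symm :
      (Fin N → H) →L[ℂ] PiLp 2 (fun _ : Fin N => H)) ∘L
    ContinuousLinearMap.pi fun i =>
      ∑ j, (A i j : H →L[ℂ] H) ∘L PiLp.proj 2 (𝕜 := ℂ) (fun _ : Fin N => H) j

/-- The orthogonal projection of `H^N` onto the closure of the image of `A`. -/
def imProj {M : VonNeumannAlgebra H} {N : ℕ} (A : Matrix (Fin N) (Fin N) M.toStarSubalgebra) :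
    PiLp 2 (fun _ : Fin N => H) →L[ℂ] PiLp 2 (fun _ : Fin N => H) :=
  haveI : CompleteSpace (matOp A).range.topologicalClosure :=
    (matOp A).range.isClosed_topologicalClosure.completeSpace_coe
  (matOp A).range.topologicalClosure.starProjection

/-- The entry at `(i, j)` of an operator on `H^N`. -/
def opEntry {N : ℕ} (p : PiLp 2 (fun _ : Fin N => H) →L[ℂ] PiLp 2 (fun _ : Fin N => H))
    (i j : Fin N) : H →L[ℂ] H :=
  PiLp.proj 2 (𝕜 := ℂ) (fun _ : Fin N => H) i ∘L p ∘L
    ((PiLp.continuousLinearEquiv 2 ℂ (fun _ : Fin N => H)).symm :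
      (Fin N → H) →L[ℂ] PiLp 2 (fun _ : Fin N => H)) ∘L
    ContinuousLinearMap.single ℂ (fun _ : Fin N => H) j

/-- The bounded operator on `H^N` that applies `g` to every coordinate. -/
def diagOp (N : ℕ) (g : H →L[ℂ] H) :
    PiLp 2 (fun _ : Fin N => H) →L[ℂ] PiLp 2 (fun _ : Fin N => H) :=
  ((PiLp.continuousLinearEquiv 2 ℂ (fun _ : Fin N => H)).symm :
      (Fin N → H) →L[ℂ] PiLp 2 (fun _ : Fin N => H)) ∘L
    ContinuousLinearMap.pi fun i => g ∘L PiLp.proj 2 (𝕜 := ℂ) (fun _ : Fin N => H) i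

theorem diagOp_apply (N : ℕ) (g : H →L[ℂ] H) (v : PiLp 2 (fun _ : Fin N => H)) (i : Fin N) :
    diagOp N g v i = g (v i) := rfl

theorem matOp_apply {M : VonNeumannAlgebra H} {N : ℕ}
    (A : Matrix (Fin N) (Fin N) M.toStarSubalgebra) (v : PiLp 2 (fun _ : Fin N => H)) (i : Fin N) :
    matOp A v i = ∑ j, (A i j : H →L[ℂ] H) (v j) := by
  simp [matOp]

theorem diagOp_mem_closure {M : VonNeumannAlgebra H} {N : ℕ}
    (A : Matrix (Fin N) (Fin N) M.toStarSubalgebra) {g : H →L[ℂ] H} (hg : g ∈ M.commutant)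
    {v : PiLp 2 (fun _ : Fin N => H)} (hv : v ∈ (matOp A).range.topologicalClosure) :
    diagOp N g v ∈ (matOp A).range.topologicalClosure := by
  rw [← SetLike.mem_coe, Submodule.topologicalClosure_coe] at hv ⊢
  refine map_mem_closure (diagOp N g).continuous hv ?_
  rintro _ ⟨w, rfl⟩
  refine ⟨diagOp N g w, ?_⟩
  ext i
  simp only [ContinuousLinearMap.coe_coe, diagOp_apply, matOp_apply, map_sum]
  refine Finset.sum_congr rfl fun j _ => ?_
  exact congrArg (fun f : H →L[ℂ] H => f (w j))
    (VonNeumannAlgebra.mem_commutant_iff.1 hg (A i j) (A i j).2)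

theorem imProj_diagOp {M : VonNeumannAlgebra H} {N : ℕ}
    (A : Matrix (Fin N) (Fin N) M.toStarSubalgebra) {g : H →L[ℂ] H} (hg : g ∈ M.commutant)
    (v : PiLp 2 (fun _ : Fin N => H)) : imProj A (diagOp N g v) = diagOp N g (imProj A v) := by
  have : CompleteSpace (matOp A).range.topologicalClosure :=
    (matOp A).range.isClosed_topologicalClosure.completeSpace_coe
  refine Submodule.eq_starProjection_of_mem_of_inner_eq_zero
    (diagOp_mem_closure A hg (Submodule.starProjection_apply_mem _ v)) fun w hw => ?_
  have h := Submodule.starProjection_inner_eq_zero (K := (matOp A).range.topologicalClosure)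
    v _ (diagOp_mem_closure A (star_mem hg) hw)
  rw [← map_sub, PiLp.inner_apply]
  rw [PiLp.inner_apply] at h
  rw [← h]
  refine Finset.sum_congr rfl fun i _ => ?_
  rw [diagOp_apply, diagOp_apply, ContinuousLinearMap.star_eq_adjoint,
    ContinuousLinearMap.adjoint_inner_right]
  rfl

/-- The entries of the projection onto the closure of the image of `A` lie in `M`. -/
theorem opEntry_imProj_mem {M : VonNeumannAlgebra H} {N : ℕ}
    (A : Matrix (Fin N) (Fin N) M.toStarSubalgebra) (i j : Fin N) :
    opEntry (imProj A) i j ∈ M.toStarSubalgebra := by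
  suffices h : opEntry (imProj A) i j ∈ M.commutant.commutant by
    rwa [M.commutant_commutant] at h
  rw [VonNeumannAlgebra.mem_commutant_iff]
  intro g hg
  ext x
  have key : diagOp N g (WithLp.toLp 2 (Pi.single j x)) = WithLp.toLp 2 (Pi.single j (g x)) := by
    ext k
    rw [diagOp_apply]
    by_cases hk : k = j
    · subst hk; simp
    · simp [hk]
  change g (imProj A (WithLp.toLp 2 (Pi.single j x)) i) =
    imProj A (WithLp.toLp 2 (Pi.single j (g x))) i
  rw [← key, imProj_diagOp A hg, diagOp_apply]

/-- The analytic rank `(Tr_N ∘ τ^(N)) (p)` of a matrix over `M`, where `p` is the orthogonal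
projection onto the closure of its image. (This trace is a real number.) -/
def rank {M : VonNeumannAlgebra H} (τ : M.toStarSubalgebra →ₗ[ℂ] ℂ) {N : ℕ}
    (A : Matrix (Fin N) (Fin N) M.toStarSubalgebra) : ℝ :=
  (∑ i, τ ⟨opEntry (imProj A) i i, opEntry_imProj_mem A i i⟩).re

/-- The analytic rank of `P(X)`. -/
def rankEv {M : VonNeumannAlgebra H} (τ : M.toStarSubalgebra →ₗ[ℂ] ℂ) {n N : ℕ}
    (X : Fin n → M.toStarSubalgebra) (P : Matrix (Fin N) (Fin N) (FreeAlgebra ℂ (Fin n))) : ℝ :=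
  rank τ (P.map (FreeAlgebra.lift ℂ X))

/-- The strong Atiyah property of the tuple `X`. -/
def StrongAtiyah {M : VonNeumannAlgebra H} (τ : M.toStarSubalgebra →ₗ[ℂ] ℂ) {n : ℕ}
    (X : Fin n → M.toStarSubalgebra) : Prop :=
  ∀ (N : ℕ) (P : Matrix (Fin N) (Fin N) (FreeAlgebra ℂ (Fin n))), ∃ k : ℕ, rankEv τ X P = k

end AtiyahProperty

end

/-!
The operators affiliated with `M` form a ring `Aff` in which injective elements of `M` are
invertible, and whose elements are the fractions `a b⁻¹` with `a, b` in `M` and `b` injective. Both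
facts come from the von Neumann dimension of the closed subspaces of `H ⊕ ⋯ ⊕ H` invariant
under the commutant of `M`, the trace of their projections. The only nontrivial property of this
dimension is the rank-nullity formula `vdim_range_add_vdim_ker`, a consequence of the polar
decomposition and of the trace property; faithfulness makes the dimension strictly monotone. Square
matrices over `M` are therefore injective if and only if they have dense range, which yields the
Ore condition `MatInj.exists_mul_eq_mul`.
The graph of an affiliated operator has dimension one; so an affiliated operator is determined by
its restriction to the range of a single injective `b`, and the closures in the definition of the
sum and the product are closures of graphs of dimension at most one, hence again graphs
(`closure_mem_affiliated`). The ring axioms can then be checked on the range of a suitable `b`.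

A square matrix over `M` is invertible over `Aff` exactly when its kernel vanishes, that is, when
its analytic rank is its size (`MatInj.exists_inverse`, `matInj_of_mul_matIncl`). Clearing
denominators shows that the analytic rank is at most the inner dimension of any factorization over
`Aff` (`mrank_le_of_factorization`), and at least the size of any identity matrix that factors
through the given one (`card_le_mrank`).

The equivalence now rests on linear representations `t = u P⁻¹ v` of the elements of the rational
closure and on the bordered matrix with blocks `P`, `v`, `u`, `0`, which over `Aff` is equivalent to
`P ⊕ (-t)`.
* Its analytic rank lies between the size of `P` and that size plus one, and the lower value
  forces `t = 0`. Under the strong Atiyah property no other values are possible, so that `t` is zero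
  or invertible (`eq_zero_or_matInj_of_bordered`), and the inverse is again in the rational closure.
* If the rational closure is a division ring, rank factorizations over it compute both ranks
  (`rankEv_eq_innerRank`), and the analytic rank of full matrices is their size.
* If `t ≠ 0`, the bordered matrix is full, as the matrix rings over `Aff` are Dedekind-finite; if
  full matrices are invertible, then so is `t` (`hasInverses_of_full`).
* Over a division ring, a matrix that is invertible over a larger ring has its inverse over the
  division ring. So if the division closure is a division ring, it contains the rational closure;
  conversely, the division closure is contained in the rational closure and closed under inverses
  (`hasInverses_ratSubring_iff`).
-/

noncomputable section
namespace AtiyahProperty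

/-! ### Polar decomposition -/

section Polar

variable {E F : Type*} [NormedAddCommGroup E] [InnerProductSpace ℂ E] [CompleteSpace E]
  [NormedAddCommGroup F] [InnerProductSpace ℂ F] [CompleteSpace F]

/-- The absolute value of a bounded operator between different Hilbert spaces. -/
theorem exists_absoluteValue (T : E →L[ℂ] F) :
    ∃ S : E →L[ℂ] E, IsSelfAdjoint S ∧ S * S = T.adjoint ∘L T ∧
      ∀ D : E →L[ℂ] E, Commute (T.adjoint ∘L T) D → Commute S D := by
  have hpos : (0 : E →L[ℂ] E) ≤ T.adjoint ∘L T :=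
    (ContinuousLinearMap.nonneg_iff_isPositive _).2
      (ContinuousLinearMap.isPositive_adjoint_comp_self T)
  refine ⟨CFC.sqrt (T.adjoint ∘L T), (CFC.sqrt_nonneg _).isSelfAdjoint,
    CFC.sqrt_mul_sqrt_self _ hpos, fun D hD => ?_⟩
  rw [CFC.sqrt_eq_cfc]
  exact Commute.cfc_nnreal hD _

/-- Bounded operators agree if they agree on the range of `S` and on its orthogonal complement. -/
theorem ext_of_range_of_orthogonal {G : Type*} [NormedAddCommGroup G] [InnerProductSpace ℂ G]
    (S : E →L[ℂ] E) {A B : E →L[ℂ] G} (h1 : ∀ x, A (S x) = B (S x))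
    (h2 : ∀ x ∈ S.range.topologicalClosureᗮ, A x = B x) : A = B := by
  have : CompleteSpace S.range.topologicalClosure :=
    S.range.isClosed_topologicalClosure.completeSpace_coe
  have h3 : ∀ x ∈ S.range.topologicalClosure, A x = B x := by
    intro x hx
    have hx' : x ∈ closure (S.range : Set E) := by
      rw [← Submodule.topologicalClosure_coe]; exact hx
    refine closure_minimal (t := {x | A x = B x}) ?_ (isClosed_eq A.continuous B.continuous) hx'
    rintro _ ⟨y, rfl⟩
    exact h1 y
  ext x
  obtain ⟨y, hy, z, hz, rfl⟩ := S.range.topologicalClosure.exists_add_mem_mem_orthogonal x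
  rw [map_add, map_add, h3 y hy, h2 z hz]

/-- The polar decomposition: every bounded operator `T` has a partial isometry `U` from the
orthogonal complement of the kernel of `T` onto the closure of the range of `T`, and `U`
intertwines whatever both `T` and its adjoint intertwine. -/
theorem exists_polar (T : E →L[ℂ] F) :
    ∃ U : E →L[ℂ] F,
      U.adjoint ∘L U = T.kerᗮ.starProjection ∧
      (∀ y, U (U.adjoint (T y)) = T y) ∧
      (∀ x, U x ∈ T.range.topologicalClosure) ∧
      ∀ (D : E →L[ℂ] E) (D' : F →L[ℂ] F), T ∘L D = D' ∘L T → T.adjoint ∘L D' = D ∘L T.adjoint →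
        U ∘L D = D' ∘L U := by
  obtain ⟨S, hSsa, hSS, hScomm⟩ := exists_absoluteValue T
  have hadj : S.adjoint = S := hSsa
  have hinner : ∀ x y, inner ℂ (S x) (S y) = inner ℂ (T x) (T y) := by
    intro x y
    rw [← ContinuousLinearMap.adjoint_inner_right, hadj, ← ContinuousLinearMap.adjoint_inner_right]
    exact congrArg (fun f : E →L[ℂ] E => inner ℂ x (f y)) hSS
  have hnorm : ∀ x, ‖T x‖ = ‖S x‖ := by
    intro x
    have := hinner x x
    rw [inner_self_eq_norm_sq_to_K, inner_self_eq_norm_sq_to_K] at this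
    have h2 : ‖S x‖ ^ 2 = ‖T x‖ ^ 2 := by exact_mod_cast this
    exact ((sq_eq_sq₀ (norm_nonneg _) (norm_nonneg _)).1 h2).symm
  have hker : S.ker = T.ker := by
    ext x
    simp only [LinearMap.mem_ker, ContinuousLinearMap.coe_coe]
    rw [← norm_eq_zero, ← hnorm, norm_eq_zero]
  set K : Submodule ℂ E := S.range.topologicalClosure with hK
  have hKT : T.kerᗮ = K := by
    rw [← hker, ContinuousLinearMap.orthogonal_ker, hadj]
  have : CompleteSpace K := S.range.isClosed_topologicalClosure.completeSpace_coe
  let e : E →ₗ[ℂ] K := LinearMap.codRestrict K S fun x =>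
    S.range.le_topologicalClosure ⟨x, rfl⟩
  have he : DenseRange e := by
    intro z
    have hz : (z : E) ∈ closure (S.range : Set E) := by
      rw [← Submodule.topologicalClosure_coe]; exact z.2
    rw [closure_subtype]
    refine closure_mono ?_ hz
    rintro _ ⟨x, rfl⟩
    exact ⟨e x, ⟨x, rfl⟩, rfl⟩
  have hbound : ∃ C : ℝ, ∀ x, ‖(T : E →ₗ[ℂ] F) x‖ ≤ C * ‖e x‖ :=
    ⟨1, fun x => by rw [one_mul]; exact (hnorm x).le⟩
  set V : K →L[ℂ] F := (T : E →ₗ[ℂ] F).extendOfNorm e with hV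
  have hVe : ∀ x, V (e x) = T x := fun x => LinearMap.extendOfNorm_eq he hbound x
  set U : E →L[ℂ] F := V ∘L K.orthogonalProjectionOnto with hU
  have hUS : ∀ x, U (S x) = T x := by
    intro x
    have : K.orthogonalProjectionOnto (S x) = e x :=
      Submodule.orthogonalProjectionOnto_mem_subspace_eq_self (K := K) (e x)
    rw [hU, ContinuousLinearMap.comp_apply, this, hVe]
  have hUperp : ∀ x ∈ Kᗮ, U x = 0 := by
    intro x hx
    rw [hU, ContinuousLinearMap.comp_apply,
      Submodule.orthogonalProjectionOnto_apply_of_mem_orthogonal hx, map_zero]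
  have hUU : U.adjoint ∘L U = K.starProjection := by
    refine ext_of_range_of_orthogonal S (fun x => ?_) (fun x hx => ?_)
    · rw [ContinuousLinearMap.comp_apply, hUS, (K.starProjection_eq_self_iff (v := S x)).2
        (S.range.le_topologicalClosure ⟨x, rfl⟩)]
      refine ext_inner_right ℂ fun w => ?_
      rw [ContinuousLinearMap.adjoint_inner_left]
      obtain ⟨y, hy, z, hz, rfl⟩ := K.exists_add_mem_mem_orthogonal w
      have h0 : inner ℂ (S x) z = 0 :=
        Submodule.inner_right_of_mem_orthogonal (S.range.le_topologicalClosure ⟨x, rfl⟩) hz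
      rw [map_add, hUperp z hz, add_zero, inner_add_right, h0, add_zero]
      have hy' : y ∈ closure (S.range : Set E) := by
        rw [← Submodule.topologicalClosure_coe]; exact hy
      refine closure_minimal (t := {y | inner ℂ (T x) (U y) = inner ℂ (S x) y}) ?_
        (isClosed_eq (by fun_prop) (by fun_prop)) hy'
      rintro _ ⟨v, rfl⟩
      change inner ℂ (T x) (U (S v)) = inner ℂ (S x) (S v)
      rw [hUS, hinner]
    · rw [ContinuousLinearMap.comp_apply, hUperp x hx, map_zero,
        Submodule.starProjection_apply,
        Submodule.orthogonalProjectionOnto_apply_of_mem_orthogonal hx]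
      rfl
  refine ⟨U, ?_, ?_, ?_, ?_⟩
  · simp only [hKT, hUU]
  · intro y
    have : U.adjoint (U (S y)) = S y := by
      have := congrArg (fun f : E →L[ℂ] E => f (S y)) hUU
      simp only [ContinuousLinearMap.comp_apply] at this
      rw [this, (K.starProjection_eq_self_iff (v := S y)).2
        (S.range.le_topologicalClosure ⟨y, rfl⟩)]
    rw [← hUS, this]
  · intro x
    obtain ⟨y, hy, z, hz, rfl⟩ := K.exists_add_mem_mem_orthogonal x
    rw [map_add, hUperp z hz, add_zero]
    rw [hK, ← SetLike.mem_coe, Submodule.topologicalClosure_coe] at hy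
    rw [← SetLike.mem_coe, Submodule.topologicalClosure_coe]
    refine map_mem_closure U.continuous hy ?_
    rintro _ ⟨v, rfl⟩
    exact ⟨v, (hUS v).symm⟩
  · intro D D' h1 h2
    have hc : Commute S D := by
      refine hScomm D ?_
      change (T.adjoint ∘L T) ∘L D = D ∘L (T.adjoint ∘L T)
      rw [ContinuousLinearMap.comp_assoc, h1, ← ContinuousLinearMap.comp_assoc, h2,
        ContinuousLinearMap.comp_assoc]
    have hc' : ∀ x, S (D x) = D (S x) := fun x => congrArg (fun f : E →L[ℂ] E => f x) hc.eq
    refine ext_of_range_of_orthogonal S (fun x => ?_) (fun x hx => ?_)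
    · change U (D (S x)) = D' (U (S x))
      rw [← hc', hUS, hUS]
      exact congrArg (fun f : E →L[ℂ] F => f x) h1
    · have hKp : Kᗮ = S.ker := by
        rw [← hKT, hker]
        have : CompleteSpace T.ker := T.isClosed_ker.completeSpace_coe
        exact Submodule.orthogonal_orthogonal _
      change U (D x) = D' (U x)
      rw [hUperp x hx, map_zero]
      refine hUperp _ ?_
      rw [hKp, LinearMap.mem_ker, ContinuousLinearMap.coe_coe] at hx ⊢
      rw [hc', hx, map_zero]

end Polar

variable {H : Type*} [NormedAddCommGroup H] [InnerProductSpace ℂ H] [CompleteSpace H]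

/-! ### Matrices over `M` as operators between amplifications of `H` -/

section Amplification

variable {M : VonNeumannAlgebra H} {ι κ l : Type*} [Fintype ι] [Fintype κ] [Fintype l]
  [DecidableEq ι] [DecidableEq κ] [DecidableEq l]

/-- The Hilbert space sum of copies of `H` indexed by `ι`. -/
abbrev Amp (H : Type*) [NormedAddCommGroup H] [InnerProductSpace ℂ H] (ι : Type*) : Type _ :=
  PiLp 2 (fun _ : ι => H)

/-- The bounded operator given by a rectangular matrix over `M`. -/
def mulOp (A : Matrix κ ι M.toStarSubalgebra) : Amp H ι →L[ℂ] Amp H κ :=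
  ((PiLp.continuousLinearEquiv 2 ℂ (fun _ : κ => H)).symm : (κ → H) →L[ℂ] Amp H κ) ∘L
    ContinuousLinearMap.pi fun i =>
      ∑ j, (A i j : H →L[ℂ] H) ∘L PiLp.proj 2 (𝕜 := ℂ) (fun _ : ι => H) j

theorem mulOp_apply (A : Matrix κ ι M.toStarSubalgebra) (v : Amp H ι) (i : κ) :
    mulOp A v i = ∑ j, (A i j : H →L[ℂ] H) (v j) := by
  simp [mulOp]

/-- The vector with entry `x` at `j` and zeros elsewhere. -/
def coordVec (j : ι) (x : H) : Amp H ι := WithLp.toLp 2 (Pi.single j x)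

theorem coordVec_apply (j i : ι) (x : H) : coordVec j x i = if i = j then x else 0 := by
  rw [coordVec, ← Pi.single_apply]

theorem mulOp_coordVec (A : Matrix κ ι M.toStarSubalgebra) (j : ι) (x : H) (i : κ) :
    mulOp A (coordVec j x) i = (A i j : H →L[ℂ] H) x := by
  rw [mulOp_apply, Finset.sum_eq_single j]
  · rw [coordVec_apply, if_pos rfl]
  · intro b _ hb; rw [coordVec_apply, if_neg hb, map_zero]
  · simp

theorem sum_coordVec (v : Amp H ι) : ∑ j, coordVec j (v j) = v := by
  ext i
  simp [coordVec_apply]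

theorem mulOp_injective {A B : Matrix κ ι M.toStarSubalgebra} (h : mulOp A = mulOp B) : A = B := by
  ext i j x
  rw [← mulOp_coordVec A j x i, h, mulOp_coordVec]

theorem mulOp_mul (A : Matrix κ ι M.toStarSubalgebra) (B : Matrix ι l M.toStarSubalgebra)
    (v : Amp H l) : mulOp (A * B) v = mulOp A (mulOp B v) := by
  ext i
  simp only [mulOp_apply, Matrix.mul_apply, map_sum, AddSubmonoidClass.coe_finsetSum,
    sum_apply]
  rw [Finset.sum_comm]
  rfl

theorem mulOp_one (v : Amp H ι) : mulOp (1 : Matrix ι ι M.toStarSubalgebra) v = v := by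
  ext i
  rw [mulOp_apply, Finset.sum_eq_single i]
  · simp
  · intro b _ hb; rw [Matrix.one_apply_ne hb.symm]; rfl
  · simp

theorem mulOp_zero (v : Amp H ι) : mulOp (0 : Matrix κ ι M.toStarSubalgebra) v = 0 := by
  ext i; simp [mulOp_apply]

theorem mulOp_sub (A B : Matrix κ ι M.toStarSubalgebra) (v : Amp H ι) :
    mulOp (A - B) v = mulOp A v - mulOp B v := by
  ext i; simp [mulOp_apply]

theorem inner_mulOp (A : Matrix κ ι M.toStarSubalgebra) (v : Amp H ι) (w : Amp H κ) :
    inner ℂ (mulOp A v) w = inner ℂ v (mulOp A.conjTranspose w) := by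
  simp only [PiLp.inner_apply, mulOp_apply, sum_inner, inner_sum, Matrix.conjTranspose_apply]
  rw [Finset.sum_comm]
  refine Finset.sum_congr rfl fun j _ => Finset.sum_congr rfl fun i _ => ?_
  exact (ContinuousLinearMap.adjoint_inner_right _ _ _).symm

theorem adjoint_mulOp (A : Matrix κ ι M.toStarSubalgebra) :
    (mulOp A).adjoint = mulOp A.conjTranspose := by
  refine (ContinuousLinearMap.eq_adjoint_iff _ _).2 (fun w v => ?_) |>.symm
  rw [inner_mulOp, Matrix.conjTranspose_conjTranspose]

/-- The operator applying `g` to every coordinate. -/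
def ampOp (ι : Type*) [Fintype ι] (g : H →L[ℂ] H) : Amp H ι →L[ℂ] Amp H ι :=
  ((PiLp.continuousLinearEquiv 2 ℂ (fun _ : ι => H)).symm : (ι → H) →L[ℂ] Amp H ι) ∘L
    ContinuousLinearMap.pi fun i => g ∘L PiLp.proj 2 (𝕜 := ℂ) (fun _ : ι => H) i

theorem ampOp_apply (g : H →L[ℂ] H) (v : Amp H ι) (i : ι) : ampOp ι g v i = g (v i) := rfl

theorem ampOp_coordVec (g : H →L[ℂ] H) (j : ι) (x : H) :
    ampOp ι g (coordVec j x) = coordVec j (g x) := by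
  ext i
  rw [ampOp_apply, coordVec_apply, coordVec_apply]
  split_ifs <;> simp

theorem mulOp_ampOp (A : Matrix κ ι M.toStarSubalgebra) {g : H →L[ℂ] H} (hg : g ∈ M.commutant)
    (v : Amp H ι) : mulOp A (ampOp ι g v) = ampOp κ g (mulOp A v) := by
  ext i
  simp only [ampOp_apply, mulOp_apply, map_sum]
  refine Finset.sum_congr rfl fun j _ => ?_
  exact congrArg (fun f : H →L[ℂ] H => f (v j))
    (VonNeumannAlgebra.mem_commutant_iff.1 hg (A i j) (A i j).2)

/-- An operator between amplifications commuting with the diagonal action of the commutant is a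
matrix over `M`: this is the double commutant property of `M`. -/
theorem exists_mulOp_eq (T : Amp H ι →L[ℂ] Amp H κ)
    (hT : ∀ g ∈ M.commutant, ∀ v, T (ampOp ι g v) = ampOp κ g (T v)) :
    ∃ A : Matrix κ ι M.toStarSubalgebra, mulOp A = T := by
  let t : κ → ι → H →L[ℂ] H := fun i j =>
    PiLp.proj 2 (𝕜 := ℂ) (fun _ : κ => H) i ∘L T ∘L
      ((PiLp.continuousLinearEquiv 2 ℂ (fun _ : ι => H)).symm : (ι → H) →L[ℂ] Amp H ι) ∘L
        ContinuousLinearMap.single ℂ (fun _ : ι => H) j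
  have ht : ∀ i j x, t i j x = T (coordVec j x) i := fun _ _ _ => rfl
  have hmem : ∀ i j, t i j ∈ M.toStarSubalgebra := by
    intro i j
    suffices h : t i j ∈ M.commutant.commutant by
      rwa [M.commutant_commutant] at h
    rw [VonNeumannAlgebra.mem_commutant_iff]
    intro g hg
    ext x
    change g (t i j x) = t i j (g x)
    rw [ht, ht, ← ampOp_coordVec, hT g hg, ampOp_apply]
  refine ⟨Matrix.of fun i j => ⟨t i j, hmem i j⟩, ?_⟩
  ext v i
  rw [← sum_coordVec v, map_sum, map_sum]
  simp only [WithLp.ofLp_sum, Finset.sum_apply]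
  refine Finset.sum_congr rfl fun j _ => ?_
  rw [mulOp_coordVec]
  exact ht i j _

/-- A subspace of an amplification of `H` is *affiliated* with `M` if it is closed and invariant
under the diagonal action of the commutant of `M`. -/
def IsAff (M : VonNeumannAlgebra H) (K : Submodule ℂ (Amp H ι)) : Prop :=
  IsClosed (K : Set (Amp H ι)) ∧ ∀ g ∈ M.commutant, ∀ v ∈ K, ampOp ι g v ∈ K

theorem isAff_closure {K : Submodule ℂ (Amp H ι)}
    (h : ∀ g ∈ M.commutant, ∀ v ∈ K, ampOp ι g v ∈ K) : IsAff M K.topologicalClosure := by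
  refine ⟨K.isClosed_topologicalClosure, fun g hg v hv => ?_⟩
  rw [← SetLike.mem_coe, Submodule.topologicalClosure_coe] at hv ⊢
  exact map_mem_closure (ampOp ι g).continuous hv (h g hg)

theorem isAff_range_closure (A : Matrix κ ι M.toStarSubalgebra) :
    IsAff M (mulOp A).range.topologicalClosure := by
  refine isAff_closure ?_
  rintro g hg _ ⟨w, rfl⟩
  exact ⟨ampOp ι g w, mulOp_ampOp A hg w⟩

theorem isAff_map_closure (A : Matrix κ ι M.toStarSubalgebra) {K : Submodule ℂ (Amp H ι)}
    (hK : IsAff M K) : IsAff M (K.map (mulOp A : Amp H ι →ₗ[ℂ] Amp H κ)).topologicalClosure := by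
  refine isAff_closure ?_
  rintro g hg _ ⟨w, hw, rfl⟩
  exact ⟨ampOp ι g w, hK.2 g hg w hw, mulOp_ampOp A hg w⟩

theorem isAff_ker (A : Matrix κ ι M.toStarSubalgebra) : IsAff M (mulOp A).ker := by
  refine ⟨(mulOp A).isClosed_ker, fun g hg v hv => ?_⟩
  rw [LinearMap.mem_ker, ContinuousLinearMap.coe_coe] at hv ⊢
  rw [mulOp_ampOp A hg, hv, map_zero]

theorem isAff_orthogonal {K : Submodule ℂ (Amp H ι)} (hK : IsAff M K) : IsAff M Kᗮ := by
  refine ⟨K.isClosed_orthogonal, fun g hg v hv => ?_⟩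
  rw [Submodule.mem_orthogonal] at hv ⊢
  intro u hu
  have h := hv _ (hK.2 _ (star_mem hg) u hu)
  rw [← h, PiLp.inner_apply, PiLp.inner_apply]
  refine Finset.sum_congr rfl fun i _ => ?_
  rw [ampOp_apply, ampOp_apply, ContinuousLinearMap.star_eq_adjoint,
    ContinuousLinearMap.adjoint_inner_left]

theorem isAff_top : IsAff M (⊤ : Submodule ℂ (Amp H ι)) :=
  ⟨isClosed_univ, fun _ _ _ _ => trivial⟩

theorem isAff_bot : IsAff M (⊥ : Submodule ℂ (Amp H ι)) := by
  refine ⟨isClosed_singleton, fun g _ v hv => ?_⟩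
  rw [Submodule.mem_bot] at hv ⊢
  rw [hv, map_zero]

/-- The matrix `P` over `M` is the orthogonal projection onto `K`. -/
structure IsProjOnto (P : Matrix ι ι M.toStarSubalgebra) (K : Submodule ℂ (Amp H ι)) : Prop where
  conj : P.conjTranspose = P
  mem : ∀ v, mulOp P v ∈ K
  apply : ∀ v ∈ K, mulOp P v = v

theorem IsAff.exists_isProjOnto {K : Submodule ℂ (Amp H ι)} (hK : IsAff M K) :
    ∃ P : Matrix ι ι M.toStarSubalgebra, IsProjOnto P K := by
  have : CompleteSpace K := hK.1.completeSpace_coe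
  obtain ⟨P, hP⟩ := exists_mulOp_eq (M := M) K.starProjection (fun g hg v => by
    refine Submodule.eq_starProjection_of_mem_of_inner_eq_zero
      (hK.2 g hg _ (K.starProjection_apply_mem v)) fun w hw => ?_
    rw [← map_sub]
    exact Submodule.inner_left_of_mem_orthogonal hw
      ((isAff_orthogonal hK).2 g hg _ (K.sub_starProjection_mem_orthogonal v)))
  refine ⟨P, mulOp_injective ?_, fun v => ?_, fun v hv => ?_⟩
  · rw [← adjoint_mulOp, hP]
    exact isSelfAdjoint_starProjection K
  · rw [hP]; exact K.starProjection_apply_mem v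
  · rw [hP]; exact K.starProjection_eq_self_iff.2 hv

theorem IsProjOnto.mul_eq {P Q : Matrix ι ι M.toStarSubalgebra} {K L : Submodule ℂ (Amp H ι)}
    (hP : IsProjOnto P K) (hQ : IsProjOnto Q L) (h : K ≤ L) : Q * P = P := by
  refine mulOp_injective (ContinuousLinearMap.ext fun v => ?_)
  rw [mulOp_mul, hQ.apply _ (h (hP.mem v))]

theorem IsProjOnto.mul_eq' {P Q : Matrix ι ι M.toStarSubalgebra} {K L : Submodule ℂ (Amp H ι)}
    (hP : IsProjOnto P K) (hQ : IsProjOnto Q L) (h : K ≤ L) : P * Q = P := by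
  have := congrArg Matrix.conjTranspose (hP.mul_eq hQ h)
  rwa [Matrix.conjTranspose_mul, hP.conj, hQ.conj] at this

theorem IsProjOnto.unique {P Q : Matrix ι ι M.toStarSubalgebra} {K : Submodule ℂ (Amp H ι)}
    (hP : IsProjOnto P K) (hQ : IsProjOnto Q K) : P = Q := by
  rw [← hP.mul_eq hQ le_rfl, hQ.mul_eq' hP le_rfl]

theorem isProjOnto_top : IsProjOnto (1 : Matrix ι ι M.toStarSubalgebra) ⊤ :=
  ⟨Matrix.conjTranspose_one, fun _ => trivial, fun v _ => mulOp_one v⟩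

theorem isProjOnto_bot : IsProjOnto (0 : Matrix ι ι M.toStarSubalgebra) ⊥ :=
  ⟨Matrix.conjTranspose_zero, fun v => mulOp_zero v,
    fun v hv => by rw [(Submodule.mem_bot ℂ).1 hv, map_zero]⟩

theorem IsProjOnto.orthogonal {P : Matrix ι ι M.toStarSubalgebra} {K : Submodule ℂ (Amp H ι)}
    (hP : IsProjOnto P K) : IsProjOnto (1 - P) Kᗮ := by
  refine ⟨by rw [Matrix.conjTranspose_sub, hP.conj, Matrix.conjTranspose_one], fun v => ?_,
    fun v hv => ?_⟩
  · rw [Submodule.mem_orthogonal]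
    intro u hu
    rw [mulOp_sub, mulOp_one, inner_sub_right, sub_eq_zero]
    conv_rhs => rw [← hP.conj, ← inner_mulOp, hP.apply u hu]
  · rw [mulOp_sub, mulOp_one, sub_eq_self]
    have h := hP.mem v
    have h2 : inner ℂ (mulOp P v) (mulOp P v) = 0 := by
      rw [inner_mulOp, hP.conj, hP.apply _ h]
      exact Submodule.inner_left_of_mem_orthogonal h hv
    exact inner_self_eq_zero.1 h2

end Amplification

/-! ### The dimension of affiliated subspaces -/

section Dimension

variable {M : VonNeumannAlgebra H} {τ : M.toStarSubalgebra →ₗ[ℂ] ℂ} {ι κ l : Type*}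
  [Fintype ι] [Fintype κ] [Fintype l] [DecidableEq ι] [DecidableEq κ] [DecidableEq l]

/-- The unnormalized trace of a matrix over `M`. -/
def tr (τ : M.toStarSubalgebra →ₗ[ℂ] ℂ) (A : Matrix ι ι M.toStarSubalgebra) : ℂ := ∑ i, τ (A i i)

theorem tr_sub (A B : Matrix ι ι M.toStarSubalgebra) : tr τ (A - B) = tr τ A - tr τ B := by
  simp [tr]

theorem tr_one (hτ : IsTracialState M τ) :
    tr τ (1 : Matrix ι ι M.toStarSubalgebra) = Fintype.card ι := by
  simp [tr, hτ.map_one]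

theorem tr_mul_comm (hτ : IsTracialState M τ) (A : Matrix κ ι M.toStarSubalgebra)
    (B : Matrix ι κ M.toStarSubalgebra) : tr τ (A * B) = tr τ (B * A) := by
  simp only [tr, Matrix.mul_apply, map_sum]
  rw [Finset.sum_comm]
  exact Finset.sum_congr rfl fun i _ => Finset.sum_congr rfl fun j _ => hτ.trace _ _

theorem tr_conjTranspose_mul_self (A : Matrix κ ι M.toStarSubalgebra) :
    tr τ (A.conjTranspose * A) = ∑ i, ∑ j, τ (star (A j i) * A j i) := by
  simp [tr, Matrix.mul_apply]

theorem tr_conjTranspose_mul_self_nonneg (hτ : IsTracialState M τ)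
    (A : Matrix κ ι M.toStarSubalgebra) : 0 ≤ (tr τ (A.conjTranspose * A)).re := by
  rw [tr_conjTranspose_mul_self]
  simp only [Complex.re_sum]
  exact Finset.sum_nonneg fun i _ => Finset.sum_nonneg fun j _ => (hτ.nonneg _).1

theorem eq_zero_of_tr_conjTranspose_mul_self (hτ : IsTracialState M τ)
    {A : Matrix κ ι M.toStarSubalgebra} (h : (tr τ (A.conjTranspose * A)).re ≤ 0) : A = 0 := by
  have h := le_antisymm h (tr_conjTranspose_mul_self_nonneg hτ A)
  rw [tr_conjTranspose_mul_self] at h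
  simp only [Complex.re_sum] at h
  rw [Finset.sum_eq_zero_iff_of_nonneg fun i _ => Finset.sum_nonneg fun j _ => (hτ.nonneg _).1] at h
  ext1 j i
  have hi := h i (Finset.mem_univ _)
  rw [Finset.sum_eq_zero_iff_of_nonneg fun j _ => (hτ.nonneg _).1] at hi
  exact hτ.faithful _ (Complex.ext (hi j (Finset.mem_univ _)) (hτ.nonneg _).2)

open Classical in
/-- The von Neumann dimension of an affiliated subspace, the trace of its projection (and zero for
subspaces that are not affiliated with `M`). -/
def vdim (τ : M.toStarSubalgebra →ₗ[ℂ] ℂ) (K : Submodule ℂ (Amp H ι)) : ℝ :=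
  if h : ∃ P : Matrix ι ι M.toStarSubalgebra, IsProjOnto P K then (tr τ h.choose).re else 0

theorem IsProjOnto.vdim_eq {P : Matrix ι ι M.toStarSubalgebra} {K : Submodule ℂ (Amp H ι)}
    (hP : IsProjOnto P K) : vdim τ K = (tr τ P).re := by
  have h : ∃ P : Matrix ι ι M.toStarSubalgebra, IsProjOnto P K := ⟨P, hP⟩
  rw [vdim, dif_pos h, h.choose_spec.unique hP]

theorem vdim_top (hτ : IsTracialState M τ) :
    vdim τ (⊤ : Submodule ℂ (Amp H ι)) = Fintype.card ι := by
  rw [isProjOnto_top.vdim_eq, tr_one hτ, Complex.natCast_re]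

theorem vdim_bot : vdim τ (⊥ : Submodule ℂ (Amp H ι)) = 0 := by
  rw [isProjOnto_bot.vdim_eq]; simp [tr]

theorem vdim_add_vdim_orthogonal (hτ : IsTracialState M τ) {K : Submodule ℂ (Amp H ι)}
    (hK : IsAff M K) : vdim τ K + vdim τ Kᗮ = Fintype.card ι := by
  obtain ⟨P, hP⟩ := hK.exists_isProjOnto
  rw [hP.vdim_eq, hP.orthogonal.vdim_eq, tr_sub, tr_one hτ]
  simp

/-- For `K ≤ L`, the difference of the projections is again a projection. -/
theorem IsProjOnto.sub_conj_mul_sub {P Q : Matrix ι ι M.toStarSubalgebra}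
    {K L : Submodule ℂ (Amp H ι)} (hP : IsProjOnto P K) (hQ : IsProjOnto Q L) (h : K ≤ L) :
    (Q - P).conjTranspose * (Q - P) = Q - P := by
  rw [Matrix.conjTranspose_sub, hP.conj, hQ.conj, mul_sub, sub_mul, sub_mul, hP.mul_eq hQ h,
    hP.mul_eq' hQ h, hP.mul_eq hP le_rfl, hQ.mul_eq hQ le_rfl, sub_self, sub_zero]

theorem vdim_mono (hτ : IsTracialState M τ) {K L : Submodule ℂ (Amp H ι)} (hK : IsAff M K)
    (hL : IsAff M L) (h : K ≤ L) : vdim τ K ≤ vdim τ L := by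
  obtain ⟨P, hP⟩ := hK.exists_isProjOnto
  obtain ⟨Q, hQ⟩ := hL.exists_isProjOnto
  have h1 := tr_conjTranspose_mul_self_nonneg hτ (Q - P)
  rw [hP.sub_conj_mul_sub hQ h, tr_sub, Complex.sub_re] at h1
  rw [hP.vdim_eq, hQ.vdim_eq]
  linarith

/-- The dimension is strictly monotone, by faithfulness of the trace. -/
theorem eq_of_le_of_vdim_le (hτ : IsTracialState M τ) {K L : Submodule ℂ (Amp H ι)}
    (hK : IsAff M K) (hL : IsAff M L) (h : K ≤ L) (hd : vdim τ L ≤ vdim τ K) : K = L := by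
  obtain ⟨P, hP⟩ := hK.exists_isProjOnto
  obtain ⟨Q, hQ⟩ := hL.exists_isProjOnto
  rw [hP.vdim_eq, hQ.vdim_eq] at hd
  have h1 : Q - P = 0 := by
    refine eq_zero_of_tr_conjTranspose_mul_self hτ ?_
    rw [hP.sub_conj_mul_sub hQ h, tr_sub, Complex.sub_re]
    linarith
  refine le_antisymm h fun v hv => ?_
  rw [← hQ.apply v hv, sub_eq_zero.1 h1]
  exact hP.mem v

theorem vdim_nonneg (hτ : IsTracialState M τ) {K : Submodule ℂ (Amp H ι)} (hK : IsAff M K) :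
    0 ≤ vdim τ K := by
  rw [← vdim_bot (M := M) (τ := τ) (ι := ι)]
  exact vdim_mono hτ isAff_bot hK bot_le

theorem vdim_le_card (hτ : IsTracialState M τ) {K : Submodule ℂ (Amp H ι)} (hK : IsAff M K) :
    vdim τ K ≤ Fintype.card ι := by
  rw [← vdim_top hτ]
  exact vdim_mono hτ hK isAff_top le_top

/-- The rank-nullity formula. The partial isometry of the polar decomposition makes the projections
onto the closure of the range and onto the orthogonal complement of the kernel equivalent, so that
they have the same trace. -/
theorem vdim_range_add_vdim_ker (hτ : IsTracialState M τ) (A : Matrix κ ι M.toStarSubalgebra) :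
    vdim τ (mulOp A).range.topologicalClosure + vdim τ (mulOp A).ker = Fintype.card ι := by
  obtain ⟨U, h1, h2, h3, h4⟩ := exists_polar (mulOp A)
  obtain ⟨u, rfl⟩ := exists_mulOp_eq (M := M) U (fun g hg v => by
    have := h4 (ampOp ι g) (ampOp κ g) (ContinuousLinearMap.ext fun v => mulOp_ampOp A hg v)
      (by rw [adjoint_mulOp]; exact ContinuousLinearMap.ext fun v => mulOp_ampOp _ hg v)
    exact congrArg (fun f : Amp H ι →L[ℂ] Amp H κ => f v) this)
  rw [adjoint_mulOp] at h1 h2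
  have hp : IsProjOnto (u.conjTranspose * u) (mulOp A).kerᗮ := by
    have h1' : ∀ v, mulOp (u.conjTranspose * u) v = (mulOp A).kerᗮ.starProjection v := fun v => by
      rw [mulOp_mul, ← h1]; rfl
    refine ⟨by rw [Matrix.conjTranspose_mul, Matrix.conjTranspose_conjTranspose], fun v => ?_,
      fun v hv => ?_⟩
    · rw [h1']; exact Submodule.starProjection_apply_mem _ v
    · rw [h1']; exact Submodule.starProjection_eq_self_iff.2 hv
  have hq : IsProjOnto (u * u.conjTranspose) (mulOp A).range.topologicalClosure := by
    refine ⟨by rw [Matrix.conjTranspose_mul, Matrix.conjTranspose_conjTranspose], fun v => ?_,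
      fun v hv => ?_⟩
    · rw [mulOp_mul]; exact h3 _
    · rw [← SetLike.mem_coe, Submodule.topologicalClosure_coe] at hv
      refine closure_minimal (t := {v | mulOp (u * u.conjTranspose) v = v}) ?_
        (isClosed_eq (mulOp _).continuous continuous_id) hv
      rintro _ ⟨w, rfl⟩
      change mulOp (u * u.conjTranspose) (mulOp A w) = mulOp A w
      rw [mulOp_mul, h2]
  rw [← vdim_add_vdim_orthogonal hτ (isAff_ker A), add_comm, hp.vdim_eq, hq.vdim_eq,
    tr_mul_comm hτ]

section Map

variable {K : Submodule ℂ (Amp H ι)} {P : Matrix ι ι M.toStarSubalgebra}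

theorem IsProjOnto.range_mul (hP : IsProjOnto P K) (A : Matrix κ ι M.toStarSubalgebra) :
    (mulOp (A * P)).range = K.map (mulOp A : Amp H ι →ₗ[ℂ] Amp H κ) := by
  ext w
  constructor
  · rintro ⟨v, rfl⟩
    exact ⟨mulOp P v, hP.mem v, (mulOp_mul A P v).symm⟩
  · rintro ⟨v, hv, rfl⟩
    refine ⟨v, ?_⟩
    change mulOp (A * P) v = mulOp A v
    rw [mulOp_mul, hP.apply v hv]

theorem IsProjOnto.orthogonal_le_ker (hP : IsProjOnto P K) (A : Matrix κ ι M.toStarSubalgebra) :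
    Kᗮ ≤ (mulOp (A * P)).ker := by
  intro v hv
  have h := hP.orthogonal.apply v hv
  rw [mulOp_sub, mulOp_one, sub_eq_self] at h
  rw [LinearMap.mem_ker, ContinuousLinearMap.coe_coe, mulOp_mul, h, map_zero]

/-- Images have at most the dimension of the given subspace. With `vdim_map_of_injOn` and
`injOn_of_vdim_le_vdim_map`, equality holds exactly for maps injective on the subspace. -/
theorem vdim_map_le (hτ : IsTracialState M τ) (A : Matrix κ ι M.toStarSubalgebra)
    (hK : IsAff M K) :
    vdim τ (K.map (mulOp A : Amp H ι →ₗ[ℂ] Amp H κ)).topologicalClosure ≤ vdim τ K := by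
  obtain ⟨P, hP⟩ := hK.exists_isProjOnto
  have h1 := vdim_range_add_vdim_ker hτ (A * P)
  rw [hP.range_mul] at h1
  have h2 := vdim_mono hτ (isAff_orthogonal hK) (isAff_ker (A * P)) (hP.orthogonal_le_ker A)
  have h3 := vdim_add_vdim_orthogonal hτ hK
  linarith

theorem vdim_map_of_injOn (hτ : IsTracialState M τ) (A : Matrix κ ι M.toStarSubalgebra)
    (hK : IsAff M K) (hA : ∀ v ∈ K, mulOp A v = 0 → v = 0) :
    vdim τ (K.map (mulOp A : Amp H ι →ₗ[ℂ] Amp H κ)).topologicalClosure = vdim τ K := by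
  obtain ⟨P, hP⟩ := hK.exists_isProjOnto
  have h1 := vdim_range_add_vdim_ker hτ (A * P)
  rw [hP.range_mul] at h1
  have h2 : (mulOp (A * P)).ker = Kᗮ := by
    refine le_antisymm (fun v hv => ?_) (hP.orthogonal_le_ker A)
    rw [LinearMap.mem_ker, ContinuousLinearMap.coe_coe, mulOp_mul] at hv
    have h := hP.orthogonal.mem v
    rwa [mulOp_sub, mulOp_one, hA _ (hP.mem v) hv, sub_zero] at h
  rw [h2] at h1
  have h3 := vdim_add_vdim_orthogonal hτ hK
  linarith

theorem injOn_of_vdim_le_vdim_map (hτ : IsTracialState M τ) (A : Matrix κ ι M.toStarSubalgebra)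
    (hK : IsAff M K)
    (hd : vdim τ K ≤ vdim τ (K.map (mulOp A : Amp H ι →ₗ[ℂ] Amp H κ)).topologicalClosure) :
    ∀ v ∈ K, mulOp A v = 0 → v = 0 := by
  obtain ⟨P, hP⟩ := hK.exists_isProjOnto
  have h1 := vdim_range_add_vdim_ker hτ (A * P)
  rw [hP.range_mul] at h1
  have h3 := vdim_add_vdim_orthogonal hτ hK
  have h2 := eq_of_le_of_vdim_le hτ (isAff_orthogonal hK) (isAff_ker (A * P))
    (hP.orthogonal_le_ker A) (by linarith)
  intro v hv hAv
  have h4 : v ∈ Kᗮ := by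
    rw [h2, LinearMap.mem_ker, ContinuousLinearMap.coe_coe, mulOp_mul, hP.apply v hv, hAv]
  exact inner_self_eq_zero.1 (Submodule.inner_right_of_mem_orthogonal hv h4)

end Map

end Dimension

/-! ### Injective matrices and the Ore condition -/

section Injective

variable {M : VonNeumannAlgebra H} {τ : M.toStarSubalgebra →ₗ[ℂ] ℂ} {ι κ l : Type*}
  [Fintype ι] [Fintype κ] [Fintype l] [DecidableEq ι] [DecidableEq κ] [DecidableEq l]

/-- The operator given by a matrix over `M` is injective. -/
def MatInj (A : Matrix κ ι M.toStarSubalgebra) : Prop := ∀ v, mulOp A v = 0 → v = 0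

theorem MatInj.ker_eq_bot {A : Matrix κ ι M.toStarSubalgebra} (h : MatInj A) :
    (mulOp A).ker = ⊥ :=
  (Submodule.eq_bot_iff _).2 fun v hv => h v hv

theorem MatInj.vdim_range (hτ : IsTracialState M τ) {A : Matrix κ ι M.toStarSubalgebra}
    (h : MatInj A) : vdim τ (mulOp A).range.topologicalClosure = Fintype.card ι := by
  rw [← vdim_range_add_vdim_ker hτ A, h.ker_eq_bot, vdim_bot, add_zero]

theorem MatInj.range_closure_eq_top (hτ : IsTracialState M τ) {A : Matrix κ ι M.toStarSubalgebra}
    (h : MatInj A) (hc : Fintype.card κ ≤ Fintype.card ι) :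
    (mulOp A).range.topologicalClosure = ⊤ := by
  refine eq_of_le_of_vdim_le hτ (isAff_range_closure A) isAff_top le_top ?_
  rw [vdim_top hτ, h.vdim_range hτ]
  exact_mod_cast hc

theorem matInj_one : MatInj (1 : Matrix ι ι M.toStarSubalgebra) := fun v hv => by
  rwa [mulOp_one] at hv

theorem MatInj.mul {A : Matrix κ ι M.toStarSubalgebra} {B : Matrix ι l M.toStarSubalgebra}
    (hA : MatInj A) (hB : MatInj B) : MatInj (A * B) := fun v hv =>
  hB v (hA _ (by rw [← mulOp_mul, hv]))

theorem MatInj.of_mul {A : Matrix κ ι M.toStarSubalgebra} {B : Matrix ι l M.toStarSubalgebra}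
    (h : MatInj (A * B)) : MatInj B := fun v hv =>
  h v (by rw [mulOp_mul, hv, map_zero])

/-- The compression of the projection onto `K` along a map that sends `K` to a dense subspace is
injective. -/
theorem IsProjOnto.matInj_compress {K : Submodule ℂ (Amp H ι)} {P : Matrix ι ι M.toStarSubalgebra}
    (hP : IsProjOnto P K) (T : Matrix κ ι M.toStarSubalgebra)
    (hT : (K.map (mulOp T : Amp H ι →ₗ[ℂ] Amp H κ)).topologicalClosure = ⊤) :
    MatInj (T * (P * T.conjTranspose)) := by
  intro v hv
  rw [mulOp_mul, mulOp_mul] at hv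
  have h1 : mulOp P (mulOp T.conjTranspose v) = 0 := by
    have h2 : inner ℂ (mulOp T (mulOp P (mulOp T.conjTranspose v))) v = 0 := by
      rw [hv, inner_zero_left]
    rw [inner_mulOp, ← hP.apply _ (hP.mem (mulOp T.conjTranspose v)), inner_mulOp, hP.conj] at h2
    exact inner_self_eq_zero.1 h2
  have h3 : v ∈ (K.map (mulOp T : Amp H ι →ₗ[ℂ] Amp H κ)).topologicalClosureᗮ := by
    rw [Submodule.orthogonal_closure, Submodule.mem_orthogonal]
    rintro _ ⟨w, hw, rfl⟩
    change inner ℂ (mulOp T w) v = 0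
    rw [inner_mulOp, ← hP.apply w hw, inner_mulOp, hP.conj, h1, inner_zero_right]
  rwa [hT, Submodule.top_orthogonal_eq_bot, Submodule.mem_bot] at h3

/-- The Ore condition for matrices over `M`. -/
theorem MatInj.exists_mul_eq_mul (hτ : IsTracialState M τ) {A : Matrix κ ι M.toStarSubalgebra}
    (hA : MatInj A) (hc : Fintype.card κ ≤ Fintype.card ι) (C : Matrix κ l M.toStarSubalgebra) :
    ∃ (W : Matrix ι l M.toStarSubalgebra) (B : Matrix l l M.toStarSubalgebra),
      MatInj B ∧ A * W = C * B := by
  -- the kernel of the row `(C, -A)` projects injectively and densely to the first summand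
  let N : Matrix κ (l ⊕ ι) M.toStarSubalgebra := Matrix.fromCols C (-A)
  let T : Matrix l (l ⊕ ι) M.toStarSubalgebra := Matrix.fromCols 1 0
  obtain ⟨P, hP⟩ := (isAff_ker N).exists_isProjOnto
  have hsplit : ∀ v : Amp H (l ⊕ ι), v ∈ (mulOp N).ker → mulOp T v = 0 → v = 0 := by
    intro v hv hTv
    have h1 : ∀ i, v (Sum.inl i) = 0 := by
      intro i
      have := congrArg (fun w : Amp H l => w i) hTv
      simp only [mulOp_apply, Fintype.sum_sum_type, T, Matrix.fromCols_apply_inl,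
        Matrix.fromCols_apply_inr, Matrix.one_apply] at this
      rw [Finset.sum_eq_single i] at this
      · simpa using this
      · intro j _ hj; rw [if_neg hj.symm]; rfl
      · simp
    have h2 : mulOp A (WithLp.toLp 2 fun i => v (Sum.inr i)) = 0 := by
      ext k
      have := congrArg (fun w : Amp H κ => w k) (LinearMap.mem_ker.1 hv)
      simp only [ContinuousLinearMap.coe_coe, mulOp_apply, Fintype.sum_sum_type, N,
        Matrix.fromCols_apply_inl, Matrix.fromCols_apply_inr, h1, map_zero,
        Finset.sum_const_zero, zero_add] at this
      rw [mulOp_apply]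
      simpa using this
    have h3 := hA _ h2
    ext (i | i)
    · exact h1 i
    · exact congrArg (fun w : Amp H ι => w i) h3
  have hT : ((mulOp N).ker.map (mulOp T : Amp H (l ⊕ ι) →ₗ[ℂ] Amp H l)).topologicalClosure = ⊤ := by
    refine eq_of_le_of_vdim_le hτ (isAff_map_closure T (isAff_ker N)) isAff_top le_top ?_
    rw [vdim_map_of_injOn hτ T (isAff_ker N) hsplit, vdim_top hτ]
    have h1 := vdim_range_add_vdim_ker hτ N
    have h2 := vdim_le_card hτ (isAff_range_closure N)
    rw [Fintype.card_sum] at h1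
    have h3 : (Fintype.card κ : ℝ) ≤ Fintype.card ι := by exact_mod_cast hc
    push_cast at h1
    linarith
  have hinj := hP.matInj_compress T hT
  have hNE : N * (P * T.conjTranspose) = 0 := by
    refine mulOp_injective (ContinuousLinearMap.ext fun v => ?_)
    rw [mulOp_mul, mulOp_mul, mulOp_zero]
    exact hP.mem (mulOp T.conjTranspose v)
  set E := P * T.conjTranspose with hE
  have hE' : E = Matrix.fromRows E.toRows₁ E.toRows₂ := (Matrix.fromRows_toRows E).symm
  refine ⟨E.toRows₂, E.toRows₁, ?_, ?_⟩
  · have hTE : T * E = E.toRows₁ := by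
      conv_lhs => rw [hE']
      rw [Matrix.fromCols_mul_fromRows, Matrix.one_mul, Matrix.zero_mul, add_zero]
    rwa [hTE] at hinj
  · rw [hE'] at hNE
    simp only [N, Matrix.fromCols_mul_fromRows, Matrix.neg_mul] at hNE
    rw [← sub_eq_add_neg, sub_eq_zero] at hNE
    exact hNE.symm

/-- An element of `M` is injective as an operator on `H`. -/
def ElemInj (b : M.toStarSubalgebra) : Prop := ∀ x : H, (b : H →L[ℂ] H) x = 0 → x = 0

/-- An element of `M` as a matrix with one entry. -/
def single (b : M.toStarSubalgebra) : Matrix (Fin 1) (Fin 1) M.toStarSubalgebra :=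
  Matrix.of fun _ _ => b

theorem mulOp_single (b : M.toStarSubalgebra) (v : Amp H (Fin 1)) (i : Fin 1) :
    mulOp (single b) v i = (b : H →L[ℂ] H) (v 0) := by
  simp [mulOp_apply, single]

theorem matInj_single {b : M.toStarSubalgebra} : MatInj (single b) ↔ ElemInj b := by
  constructor
  · intro h x hx
    have : mulOp (single b) (coordVec (0 : Fin 1) x) = 0 := by
      ext i; rw [mulOp_single, coordVec_apply, if_pos rfl, hx]; rfl
    have h2 := congrArg (fun w : Amp H (Fin 1) => w 0) (h _ this)
    simpa [coordVec_apply] using h2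
  · intro h v hv
    have := h (v 0) (by rw [← mulOp_single b v 0, hv]; rfl)
    ext i
    rw [Subsingleton.elim i 0, this]; rfl

theorem single_eq (A : Matrix (Fin 1) (Fin 1) M.toStarSubalgebra) : A = single (A 0 0) := by
  ext1 i j
  rw [Subsingleton.elim i 0, Subsingleton.elim j 0]; rfl

theorem ElemInj.denseRange (hτ : IsTracialState M τ) {b : M.toStarSubalgebra} (hb : ElemInj b) :
    DenseRange (b : H →L[ℂ] H) := by
  intro x
  have h := (matInj_single.2 hb).range_closure_eq_top hτ le_rfl
  have hx : coordVec (0 : Fin 1) x ∈ closure ((mulOp (single b)).range : Set (Amp H (Fin 1))) := by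
    rw [← Submodule.topologicalClosure_coe, h]; trivial
  have := map_mem_closure (t := Set.range (b : H →L[ℂ] H))
    (PiLp.proj 2 (𝕜 := ℂ) (fun _ : Fin 1 => H) 0).continuous hx (by
      rintro _ ⟨v, rfl⟩
      exact ⟨v 0, (mulOp_single b v 0).symm⟩)
  simpa [coordVec_apply] using this

theorem ElemInj.mul {a b : M.toStarSubalgebra} (ha : ElemInj a) (hb : ElemInj b) :
    ElemInj (a * b) := fun x hx => hb x (ha _ hx)

theorem elemInj_one : ElemInj (1 : M.toStarSubalgebra) := fun _ hx => hx

theorem ElemInj.exists_mul_eq_mul (hτ : IsTracialState M τ) {b : M.toStarSubalgebra}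
    (hb : ElemInj b) (c : M.toStarSubalgebra) :
    ∃ e f : M.toStarSubalgebra, ElemInj e ∧ c * e = b * f := by
  obtain ⟨W, B, hB, h⟩ := (matInj_single.2 hb).exists_mul_eq_mul hτ le_rfl (single c)
  rw [single_eq B] at hB
  refine ⟨B 0 0, W 0 0, matInj_single.1 hB, ?_⟩
  have := congrFun (congrFun h 0) 0
  simpa [Matrix.mul_apply, single] using this.symm

end Injective

/-! ### Affiliated operators through their graphs -/

section Graphs

variable {M : VonNeumannAlgebra H} {τ : M.toStarSubalgebra →ₗ[ℂ] ℂ} {ι : Type*}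
  [Fintype ι] [DecidableEq ι]

/-- The identification of `H ⊕ H` with `H × H`. -/
def pairEquiv (H : Type*) [NormedAddCommGroup H] [InnerProductSpace ℂ H] :
    Amp H (Fin 2) ≃L[ℂ] H × H :=
  (PiLp.continuousLinearEquiv 2 ℂ (fun _ : Fin 2 => H)).trans
    (ContinuousLinearEquiv.piFinTwo ℂ (fun _ => H))

/-- The graph of an unbounded operator as a subspace of the Hilbert space sum `H ⊕ H`. -/
def ampGraph (T : H →ₗ.[ℂ] H) : Submodule ℂ (Amp H (Fin 2)) :=
  T.graph.comap (pairEquiv H : Amp H (Fin 2) →ₗ[ℂ] H × H)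

theorem mem_ampGraph {T : H →ₗ.[ℂ] H} {v : Amp H (Fin 2)} :
    v ∈ ampGraph T ↔ (v 0, v 1) ∈ T.graph := Iff.rfl

/-- Affiliation in terms of the graph, which is invariant under the diagonal action of the
commutant. -/
theorem mem_affiliated_iff {T : H →ₗ.[ℂ] H} :
    T ∈ affiliated M ↔ T.IsClosed ∧ Dense (T.domain : Set H) ∧
      ∀ b ∈ M.commutant, ∀ x y, (x, y) ∈ T.graph → (b x, b y) ∈ T.graph := by
  refine and_congr_right fun _ => and_congr_right fun _ => forall₂_congr fun b _ => ?_
  constructor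
  · intro h x y hxy
    rw [LinearPMap.mem_graph_iff] at hxy
    obtain ⟨z, rfl, rfl⟩ := hxy
    obtain ⟨h1, h2⟩ := h z
    rw [LinearPMap.mem_graph_iff]
    exact ⟨⟨b z, h1⟩, rfl, h2⟩
  · intro h x
    have h1 := h x (T x) (T.mem_graph x)
    rw [LinearPMap.mem_graph_iff] at h1
    obtain ⟨z, hz1, hz2⟩ := h1
    simp only at hz1 hz2
    refine ⟨hz1 ▸ z.2, ?_⟩
    rw [← hz2]
    congr 1
    exact Subtype.ext hz1.symm

theorem isAff_ampGraph {T : H →ₗ.[ℂ] H} (hT : T ∈ affiliated M) : IsAff M (ampGraph T) := by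
  obtain ⟨h1, -, h3⟩ := mem_affiliated_iff.1 hT
  exact ⟨h1.preimage (pairEquiv H).continuous, fun g hg v hv => h3 g hg _ _ hv⟩

/-- The row that picks the first of two coordinates. -/
def firstRow (M : VonNeumannAlgebra H) : Matrix (Fin 1) (Fin 2) M.toStarSubalgebra := !![1, 0]

theorem mulOp_firstRow (v : Amp H (Fin 2)) (i : Fin 1) : mulOp (firstRow M) v i = v 0 := by
  rw [Subsingleton.elim i 0, mulOp_apply]
  simp [firstRow]

theorem eq_zero_of_firstRow {T : H →ₗ.[ℂ] H} :
    ∀ v ∈ ampGraph T, mulOp (firstRow M) v = 0 → v = 0 := by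
  intro v hv h
  have h0 : v 0 = 0 := by rw [← mulOp_firstRow (M := M) v 0, h]; rfl
  have h1 : v 1 = 0 := T.graph_fst_eq_zero_snd hv h0
  ext i
  fin_cases i
  · exact h0
  · exact h1

/-- A subspace of `H ⊕ H` whose first coordinates are dense is mapped densely to `H`. -/
theorem map_firstRow_closure_eq_top {K : Submodule ℂ (Amp H (Fin 2))}
    (h : Dense {x : H | ∃ v ∈ K, v 0 = x}) :
    (K.map (mulOp (firstRow M) : Amp H (Fin 2) →ₗ[ℂ] Amp H (Fin 1))).topologicalClosure = ⊤ := by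
  rw [eq_top_iff]
  intro w _
  rw [← SetLike.mem_coe, Submodule.topologicalClosure_coe]
  have hcont : Continuous (coordVec (0 : Fin 1) : H → Amp H (Fin 1)) :=
    (PiLp.continuous_toLp 2 _).comp (continuous_single (A := fun _ : Fin 1 => H) 0)
  have hw : w = coordVec 0 (w 0) := by
    ext i; rw [Subsingleton.elim i 0, coordVec_apply, if_pos rfl]
  rw [hw]
  refine map_mem_closure hcont (h (w 0)) ?_
  rintro _ ⟨v, hv, rfl⟩
  refine ⟨v, hv, ?_⟩
  ext i
  rw [Subsingleton.elim i 0, coordVec_apply, if_pos rfl]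
  exact mulOp_firstRow v 0

/-- The graph has dimension at most one, since its first coordinate is injective. -/
theorem vdim_ampGraph_le (hτ : IsTracialState M τ) {T : H →ₗ.[ℂ] H} (hT : T ∈ affiliated M) :
    vdim τ (ampGraph T) ≤ 1 := by
  rw [← vdim_map_of_injOn hτ (firstRow M) (isAff_ampGraph hT) eq_zero_of_firstRow]
  simpa using vdim_le_card hτ (isAff_map_closure (firstRow M) (isAff_ampGraph hT))

/-- `T` is defined on the range of `b`, and `T b = a`. -/
def Sends (T : H →ₗ.[ℂ] H) (b a : M.toStarSubalgebra) : Prop :=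
  ∀ x, ((b : H →L[ℂ] H) x, (a : H →L[ℂ] H) x) ∈ T.graph

theorem Sends.unique {T : H →ₗ.[ℂ] H} {b a a' : M.toStarSubalgebra} (h : Sends T b a)
    (h' : Sends T b a') : a = a' := by
  ext x
  exact T.mem_graph_snd_inj (h x) (h' x) rfl

theorem Sends.mul_right {T : H →ₗ.[ℂ] H} {b a : M.toStarSubalgebra} (h : Sends T b a)
    (c : M.toStarSubalgebra) : Sends T (b * c) (a * c) := fun x => h ((c : H →L[ℂ] H) x)

/-- The column with entries `b` and `a`. -/
def column (b a : M.toStarSubalgebra) : Matrix (Fin 2) (Fin 1) M.toStarSubalgebra := !![b; a]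

theorem mulOp_column_zero (b a : M.toStarSubalgebra) (v : Amp H (Fin 1)) :
    mulOp (column b a) v 0 = (b : H →L[ℂ] H) (v 0) := by
  simp [mulOp_apply, column]

theorem mulOp_column_one (b a : M.toStarSubalgebra) (v : Amp H (Fin 1)) :
    mulOp (column b a) v 1 = (a : H →L[ℂ] H) (v 0) := by
  simp [mulOp_apply, column]

/-- If `b` is injective, the graph of an affiliated operator `T` with `T b = a` is the closure of
`{(b x, a x)}`: both have dimension one. -/
theorem Sends.ampGraph_eq (hτ : IsTracialState M τ) {T : H →ₗ.[ℂ] H} (hT : T ∈ affiliated M)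
    {b a : M.toStarSubalgebra} (hb : ElemInj b) (h : Sends T b a) :
    ampGraph T = (mulOp (column b a)).range.topologicalClosure := by
  symm
  refine eq_of_le_of_vdim_le hτ (isAff_range_closure _) (isAff_ampGraph hT) ?_ ?_
  · refine Submodule.topologicalClosure_minimal _ ?_ (isAff_ampGraph hT).1
    rintro _ ⟨v, rfl⟩
    rw [mem_ampGraph, ContinuousLinearMap.coe_coe, mulOp_column_zero, mulOp_column_one]
    exact h (v 0)
  · have hinj : MatInj (column b a) := by
      intro v hv
      have := hb (v 0) (by rw [← mulOp_column_zero b a, hv]; rfl)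
      ext i
      rw [Subsingleton.elim i 0, this]; rfl
    rw [hinj.vdim_range hτ]
    simpa using vdim_ampGraph_le hτ hT

theorem Sends.ext (hτ : IsTracialState M τ) {S T : H →ₗ.[ℂ] H} (hS : S ∈ affiliated M)
    (hT : T ∈ affiliated M) {b a : M.toStarSubalgebra} (hb : ElemInj b) (h : Sends S b a)
    (h' : Sends T b a) : S = T := by
  have h1 : ampGraph S = ampGraph T := by
    rw [h.ampGraph_eq hτ hS hb, h'.ampGraph_eq hτ hT hb]
  refine LinearPMap.eq_of_eq_graph (Submodule.ext fun p => ?_)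
  have h2 := SetLike.ext_iff.1 h1 ((pairEquiv H).symm p)
  have h3 : pairEquiv H ((pairEquiv H).symm p) = p := (pairEquiv H).apply_symm_apply p
  change pairEquiv H ((pairEquiv H).symm p) ∈ S.graph ↔
    pairEquiv H ((pairEquiv H).symm p) ∈ T.graph at h2
  rwa [h3] at h2

/-- Every affiliated operator is of the form `a b⁻¹` on a dense subspace, with `b` injective: if
`P` is the projection onto the graph, then `b` and `a` are the entries of its first column. -/
theorem exists_elemInj_sends {T : H →ₗ.[ℂ] H} (hT : T ∈ affiliated M) :
    ∃ b a : M.toStarSubalgebra, ElemInj b ∧ Sends T b a := by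
  obtain ⟨P, hP⟩ := (isAff_ampGraph hT).exists_isProjOnto
  have hdense : Dense {x : H | ∃ v ∈ ampGraph T, v 0 = x} := by
    refine hT.2.1.mono fun x hx => ?_
    exact ⟨(pairEquiv H).symm (x, T ⟨x, hx⟩), T.mem_graph ⟨x, hx⟩, rfl⟩
  have h := hP.matInj_compress (firstRow M) (map_firstRow_closure_eq_top hdense)
  set E := P * (firstRow M).conjTranspose with hE
  have hE0 : firstRow M * E = single (E 0 0) := by
    rw [single_eq (firstRow M * E)]
    congr 1
    simp [Matrix.mul_apply, firstRow]
  rw [hE0, matInj_single] at h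
  refine ⟨E 0 0, E 1 0, h, fun x => ?_⟩
  have h1 := hP.mem (mulOp (firstRow M).conjTranspose (coordVec 0 x))
  rw [← mulOp_mul, ← hE, mem_ampGraph, mulOp_coordVec, mulOp_coordVec] at h1
  exact h1

/-- By the Ore condition, every `c` in `M` can be multiplied by an injective `e` so that `T` is
defined on the range of `c e`. Products of operators are evaluated by repeated use of this. -/
theorem exists_sends_mul (hτ : IsTracialState M τ) {T : H →ₗ.[ℂ] H} (hT : T ∈ affiliated M)
    (c : M.toStarSubalgebra) : ∃ e a : M.toStarSubalgebra, ElemInj e ∧ Sends T (c * e) a := by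
  obtain ⟨b, a, hb, h⟩ := exists_elemInj_sends hT
  obtain ⟨e, f, he, hef⟩ := hb.exists_mul_eq_mul hτ c
  exact ⟨e, a * f, he, hef ▸ h.mul_right f⟩

theorem Sends.dense_domain (hτ : IsTracialState M τ) {T : H →ₗ.[ℂ] H} {b a : M.toStarSubalgebra}
    (hb : ElemInj b) (h : Sends T b a) : Dense (T.domain : Set H) := by
  refine Dense.mono ?_ (hb.denseRange hτ)
  rintro _ ⟨x, rfl⟩
  exact LinearPMap.mem_domain_of_mem_graph (h x)

/-- A densely defined operator whose graph is the image of an affiliated subspace `K` on which the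
first coordinate is injective is closable, with affiliated closure. Indeed, `K` has dimension at
most one, and hence the closure of the graph meets `0 ⊕ H` in dimension zero. -/
theorem closure_mem_affiliated (hτ : IsTracialState M τ) {f : H →ₗ.[ℂ] H}
    (hf : Dense (f.domain : Set H)) {K : Submodule ℂ (Amp H ι)} (hK : IsAff M K)
    (L : Matrix (Fin 2) ι M.toStarSubalgebra)
    (hL : ∀ v ∈ K, mulOp L v 0 = 0 → v = 0)
    (hgraph : ∀ x y, (x, y) ∈ f.graph ↔ ∃ v ∈ K, mulOp L v 0 = x ∧ mulOp L v 1 = y) :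
    f.closure ∈ affiliated M := by
  have hmap : ampGraph f = K.map (mulOp L : Amp H ι →ₗ[ℂ] Amp H (Fin 2)) := by
    ext w
    rw [mem_ampGraph, hgraph]
    refine exists_congr fun v => and_congr_right fun _ => ⟨fun h => ?_, fun h => ?_⟩
    · ext i
      fin_cases i
      · exact h.1
      · exact h.2
    · rw [← h]; exact ⟨rfl, rfl⟩
  have hG : IsAff M (ampGraph f).topologicalClosure := by
    rw [hmap]; exact isAff_map_closure L hK
  have hdimK : vdim τ K ≤ 1 := by
    rw [← vdim_map_of_injOn hτ (firstRow M * L) hK fun v hv h => hL v hv (by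
      rw [← mulOp_firstRow (M := M) (mulOp L v) 0, ← mulOp_mul, h]; rfl)]
    simpa using vdim_le_card hτ (isAff_map_closure (firstRow M * L) hK)
  have hdimG : vdim τ (ampGraph f).topologicalClosure ≤ 1 := by
    rw [hmap]; exact (vdim_map_le hτ L hK).trans hdimK
  have htop : ((ampGraph f).topologicalClosure.map
      (mulOp (firstRow M) : Amp H (Fin 2) →ₗ[ℂ] Amp H (Fin 1))).topologicalClosure = ⊤ := by
    refine map_firstRow_closure_eq_top (hf.mono fun x hx => ?_)
    exact ⟨(pairEquiv H).symm (x, f ⟨x, hx⟩),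
      (ampGraph f).le_topologicalClosure (f.mem_graph ⟨x, hx⟩), rfl⟩
  have hinj := injOn_of_vdim_le_vdim_map hτ (firstRow M) hG (by
    rw [htop, vdim_top hτ]; simpa using hdimG)
  have hclos : ∀ p : H × H, p ∈ f.graph.topologicalClosure ↔
      (pairEquiv H).symm p ∈ (ampGraph f).topologicalClosure := by
    intro p
    rw [← SetLike.mem_coe, ← SetLike.mem_coe, Submodule.topologicalClosure_coe,
      Submodule.topologicalClosure_coe]
    have h1 : (ampGraph f : Set (Amp H (Fin 2))) =
        (pairEquiv H).toHomeomorph ⁻¹' (f.graph : Set (H × H)) := rfl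
    rw [h1, ← Homeomorph.preimage_closure, Set.mem_preimage]
    have h3 : (pairEquiv H).toHomeomorph ((pairEquiv H).symm p) = p :=
      (pairEquiv H).apply_symm_apply p
    rw [h3]
  have hclosable : f.IsClosable := by
    refine ⟨f.graph.topologicalClosure.toLinearPMap, ?_⟩
    rw [Submodule.toLinearPMap_graph_eq]
    rintro ⟨x, y⟩ hxy rfl
    rw [hclos] at hxy
    have h1 := hinj _ hxy (by ext i; exact mulOp_firstRow _ i)
    have h2 := (pairEquiv H).symm.map_eq_zero_iff.1 h1
    exact congrArg Prod.snd h2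
  rw [mem_affiliated_iff]
  refine ⟨hclosable.closure_isClosed, hf.mono f.le_closure.1, fun b hb x y hxy => ?_⟩
  rw [← hclosable.graph_closure_eq_closure_graph, hclos] at hxy ⊢
  have h1 : ampOp (Fin 2) b ((pairEquiv H).symm (x, y)) = (pairEquiv H).symm (b x, b y) := by
    ext i
    fin_cases i <;> rfl
  rw [← h1]
  exact hG.2 b hb _ hxy

end Graphs

/-! ### The ring of affiliated operators -/

section Operations

variable {M : VonNeumannAlgebra H} {τ : M.toStarSubalgebra →ₗ[ℂ] ℂ}

theorem mem_graph_add {S T : H →ₗ.[ℂ] H} {x w : H} :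
    (x, w) ∈ (S + T).graph ↔ ∃ y z, (x, y) ∈ S.graph ∧ (x, z) ∈ T.graph ∧ y + z = w := by
  simp only [LinearPMap.mem_graph_iff]
  constructor
  · rintro ⟨v, rfl, rfl⟩
    exact ⟨S ⟨v, v.2.1⟩, T ⟨v, v.2.2⟩, ⟨_, rfl, rfl⟩, ⟨_, rfl, rfl⟩, rfl⟩
  · rintro ⟨_, _, ⟨v, rfl, rfl⟩, ⟨w, hw, rfl⟩, rfl⟩
    refine ⟨⟨v, v.2, hw ▸ w.2⟩, rfl, ?_⟩
    rw [LinearPMap.add_apply]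
    congr 2
    exact Subtype.ext hw.symm

theorem mem_graph_pcomp {S T : H →ₗ.[ℂ] H} {x z : H} :
    (x, z) ∈ (pcomp S T).graph ↔ ∃ y, (x, y) ∈ T.graph ∧ (y, z) ∈ S.graph := by
  simp only [LinearPMap.mem_graph_iff]
  constructor
  · rintro ⟨⟨_, v, hv, rfl⟩, rfl, rfl⟩
    exact ⟨T v, ⟨v, rfl, rfl⟩, ⟨⟨T v, hv⟩, rfl, rfl⟩⟩
  · rintro ⟨_, ⟨v, rfl, rfl⟩, ⟨w, hw, rfl⟩⟩
    have hv : v ∈ S.domain.comap T.toFun := by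
      change T v ∈ S.domain
      rw [← hw]; exact w.2
    refine ⟨⟨v, ⟨v, hv, rfl⟩⟩, rfl, ?_⟩
    change S ⟨T ⟨v, _⟩, _⟩ = S w
    congr 1
    exact Subtype.ext hw.symm

theorem mem_graph_smul {T : H →ₗ.[ℂ] H} {c : ℂ} {x z : H} :
    (x, z) ∈ (c • T).graph ↔ ∃ y, (x, y) ∈ T.graph ∧ c • y = z := by
  simp only [LinearPMap.mem_graph_iff]
  constructor
  · rintro ⟨v, rfl, rfl⟩
    exact ⟨T v, ⟨v, rfl, rfl⟩, rfl⟩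
  · rintro ⟨_, ⟨v, rfl, rfl⟩, rfl⟩
    exact ⟨v, rfl, rfl⟩

theorem mem_graph_ofBounded {a : H →L[ℂ] H} {x y : H} :
    (x, y) ∈ (ofBounded a).graph ↔ a x = y := by
  rw [LinearPMap.mem_graph_iff]
  constructor
  · rintro ⟨v, rfl, rfl⟩; rfl
  · rintro rfl; exact ⟨⟨x, trivial⟩, rfl, rfl⟩

/-- The conditions `S (v i) = v j` and `T (v k) = v l` define an affiliated subspace. -/
theorem isAff_of_graphs {ι : Type*} [Fintype ι] [DecidableEq ι] {S T : H →ₗ.[ℂ] H}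
    (hS : S ∈ affiliated M) (hT : T ∈ affiliated M) (i j k l : ι) :
    ∃ K : Submodule ℂ (Amp H ι), IsAff M K ∧
      ∀ v, v ∈ K ↔ (v i, v j) ∈ S.graph ∧ (v k, v l) ∈ T.graph := by
  let p : ι → ι → Amp H ι →L[ℂ] H × H := fun i j =>
    (PiLp.proj 2 (𝕜 := ℂ) (fun _ : ι => H) i).prod (PiLp.proj 2 (𝕜 := ℂ) (fun _ : ι => H) j)
  refine ⟨S.graph.comap (p i j : Amp H ι →ₗ[ℂ] H × H) ⊓
    T.graph.comap (p k l : Amp H ι →ₗ[ℂ] H × H), ⟨?_, fun g hg v hv => ?_⟩, fun v => Iff.rfl⟩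
  · exact (hS.1.preimage (p i j).continuous).inter (hT.1.preimage (p k l).continuous)
  · exact ⟨(mem_affiliated_iff.1 hS).2.2 g hg _ _ hv.1, (mem_affiliated_iff.1 hT).2.2 g hg _ _ hv.2⟩

theorem Sends.of_le {S T : H →ₗ.[ℂ] H} {b a : M.toStarSubalgebra} (h : Sends S b a) (hST : S ≤ T) :
    Sends T b a := fun x => LinearPMap.le_graph_of_le hST (h x)

theorem Sends.add {S T : H →ₗ.[ℂ] H} {b a c : M.toStarSubalgebra} (h : Sends S b a)
    (h' : Sends T b c) : Sends (S + T) b (a + c) := fun x =>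
  mem_graph_add.2 ⟨_, _, h x, h' x, rfl⟩

theorem Sends.sAdd {S T : H →ₗ.[ℂ] H} {b a c : M.toStarSubalgebra} (h : Sends S b a)
    (h' : Sends T b c) : Sends (sAdd S T) b (a + c) :=
  (h.add h').of_le (LinearPMap.le_closure _)

theorem Sends.pcomp {S T : H →ₗ.[ℂ] H} {b a c : M.toStarSubalgebra} (h : Sends T b a)
    (h' : Sends S a c) : Sends (pcomp S T) b c := fun x =>
  mem_graph_pcomp.2 ⟨_, h x, h' x⟩

theorem Sends.sMul {S T : H →ₗ.[ℂ] H} {b a c : M.toStarSubalgebra} (h : Sends T b a)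
    (h' : Sends S a c) : Sends (sMul S T) b c :=
  (h.pcomp h').of_le (LinearPMap.le_closure _)

theorem Sends.smul {T : H →ₗ.[ℂ] H} {b a : M.toStarSubalgebra} (h : Sends T b a) (c : ℂ) :
    Sends (c • T) b (c • a) := fun x =>
  mem_graph_smul.2 ⟨_, h x, rfl⟩

theorem Sends.sSMul {T : H →ₗ.[ℂ] H} {b a : M.toStarSubalgebra} (h : Sends T b a) (c : ℂ) :
    Sends (sSMul c T) b (c • a) :=
  (h.smul c).of_le (LinearPMap.le_closure _)

theorem sends_ofBounded (a b : M.toStarSubalgebra) : Sends (ofBounded (a : H →L[ℂ] H)) b (a * b) :=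
  fun _ => mem_graph_ofBounded.2 rfl

theorem sends_one (b : M.toStarSubalgebra) : Sends sOne b b :=
  fun _ => mem_graph_ofBounded.2 rfl

theorem sends_zero (b : M.toStarSubalgebra) : Sends (0 : H →ₗ.[ℂ] H) b 0 := fun x => by
  rw [LinearPMap.mem_graph_iff]
  exact ⟨⟨(b : H →L[ℂ] H) x, trivial⟩, rfl, rfl⟩

theorem ofBounded_mem_affiliated (a : M.toStarSubalgebra) :
    ofBounded (a : H →L[ℂ] H) ∈ affiliated M := by
  rw [mem_affiliated_iff]
  refine ⟨?_, dense_univ, fun b hb x y hxy => ?_⟩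
  · have : ((ofBounded (a : H →L[ℂ] H)).graph : Set (H × H)) =
        {p | (a : H →L[ℂ] H) p.1 = p.2} := by
      ext ⟨x, y⟩
      exact mem_graph_ofBounded
    rw [LinearPMap.IsClosed, this]
    exact isClosed_eq ((a : H →L[ℂ] H).continuous.comp continuous_fst) continuous_snd
  · rw [mem_graph_ofBounded] at hxy ⊢
    rw [← hxy]
    exact (congrArg (fun f : H →L[ℂ] H => f x)
      (VonNeumannAlgebra.mem_commutant_iff.1 hb a a.2))

theorem ofBounded_zero : ofBounded (0 : H →L[ℂ] H) = 0 := by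
  refine LinearPMap.eq_of_eq_graph (Submodule.ext ?_)
  rintro ⟨x, y⟩
  rw [mem_graph_ofBounded, LinearPMap.mem_graph_iff]
  constructor
  · rintro rfl; exact ⟨⟨x, trivial⟩, rfl, rfl⟩
  · rintro ⟨v, rfl, rfl⟩; rfl

theorem zero_mem_affiliated : (0 : H →ₗ.[ℂ] H) ∈ affiliated M := by
  rw [← ofBounded_zero]; exact ofBounded_mem_affiliated 0

theorem sOne_mem_affiliated : sOne ∈ affiliated M := ofBounded_mem_affiliated 1

theorem sAdd_mem_affiliated (hτ : IsTracialState M τ) {S T : H →ₗ.[ℂ] H} (hS : S ∈ affiliated M)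
    (hT : T ∈ affiliated M) : sAdd S T ∈ affiliated M := by
  obtain ⟨b, a, hb, h⟩ := exists_elemInj_sends hS
  obtain ⟨e, c, he, h'⟩ := exists_sends_mul hτ hT b
  obtain ⟨K, hK, hKmem⟩ := isAff_of_graphs (ι := Fin 3) hS hT 0 1 0 2
  have h0 : ∀ v : Amp H (Fin 3),
      mulOp (!![1, 0, 0; 0, 1, 1] : Matrix (Fin 2) (Fin 3) M.toStarSubalgebra) v 0 = v 0 := by
    intro v; simp [mulOp_apply, Fin.sum_univ_three]
  have h1 : ∀ v : Amp H (Fin 3),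
      mulOp (!![1, 0, 0; 0, 1, 1] : Matrix (Fin 2) (Fin 3) M.toStarSubalgebra) v 1 =
        v 1 + v 2 := by
    intro v; simp [mulOp_apply, Fin.sum_univ_three]
  refine closure_mem_affiliated hτ (((h.mul_right e).add h').dense_domain hτ (hb.mul he)) hK
    !![1, 0, 0; 0, 1, 1] (fun v hv hv0 => ?_) (fun x y => ?_)
  · rw [h0] at hv0
    rw [hKmem] at hv
    ext i
    fin_cases i
    · exact hv0
    · exact S.graph_fst_eq_zero_snd hv.1 hv0
    · exact T.graph_fst_eq_zero_snd hv.2 hv0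
  · rw [mem_graph_add]
    constructor
    · rintro ⟨y, z, hy, hz, rfl⟩
      exact ⟨WithLp.toLp 2 ![x, y, z], (hKmem _).2 ⟨hy, hz⟩, h0 _, h1 _⟩
    · rintro ⟨v, hv, rfl, rfl⟩
      rw [h0, h1]
      exact ⟨v 1, v 2, ((hKmem _).1 hv).1, ((hKmem _).1 hv).2, rfl⟩

theorem sMul_mem_affiliated (hτ : IsTracialState M τ) {S T : H →ₗ.[ℂ] H} (hS : S ∈ affiliated M)
    (hT : T ∈ affiliated M) : sMul S T ∈ affiliated M := by
  obtain ⟨b, a, hb, h⟩ := exists_elemInj_sends hT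
  obtain ⟨e, c, he, h'⟩ := exists_sends_mul hτ hS a
  obtain ⟨K, hK, hKmem⟩ := isAff_of_graphs (ι := Fin 3) hT hS 0 1 1 2
  have h0 : ∀ v : Amp H (Fin 3),
      mulOp (!![1, 0, 0; 0, 0, 1] : Matrix (Fin 2) (Fin 3) M.toStarSubalgebra) v 0 = v 0 := by
    intro v; simp [mulOp_apply, Fin.sum_univ_three]
  have h1 : ∀ v : Amp H (Fin 3),
      mulOp (!![1, 0, 0; 0, 0, 1] : Matrix (Fin 2) (Fin 3) M.toStarSubalgebra) v 1 = v 2 := by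
    intro v; simp [mulOp_apply, Fin.sum_univ_three]
  refine closure_mem_affiliated hτ (((h.mul_right e).pcomp h').dense_domain hτ (hb.mul he)) hK
    !![1, 0, 0; 0, 0, 1] (fun v hv hv0 => ?_) (fun x y => ?_)
  · rw [h0] at hv0
    rw [hKmem] at hv
    have hv1 := T.graph_fst_eq_zero_snd hv.1 hv0
    ext i
    fin_cases i
    · exact hv0
    · exact hv1
    · exact S.graph_fst_eq_zero_snd hv.2 hv1
  · rw [mem_graph_pcomp]
    constructor
    · rintro ⟨z, hz, hy⟩
      exact ⟨WithLp.toLp 2 ![x, z, y], (hKmem _).2 ⟨hz, hy⟩, h0 _, h1 _⟩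
    · rintro ⟨v, hv, rfl, rfl⟩
      rw [h0, h1]
      exact ⟨v 1, ((hKmem _).1 hv).1, ((hKmem _).1 hv).2⟩

theorem sSMul_mem_affiliated (hτ : IsTracialState M τ) (c : ℂ) {T : H →ₗ.[ℂ] H}
    (hT : T ∈ affiliated M) : sSMul c T ∈ affiliated M := by
  have h0 : ∀ v : Amp H (Fin 2),
      mulOp (!![1, 0; 0, c • 1] : Matrix (Fin 2) (Fin 2) M.toStarSubalgebra) v 0 = v 0 := by
    intro v; simp [mulOp_apply, Fin.sum_univ_two]
  have h1 : ∀ v : Amp H (Fin 2),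
      mulOp (!![1, 0; 0, c • 1] : Matrix (Fin 2) (Fin 2) M.toStarSubalgebra) v 1 = c • v 1 := by
    intro v; simp [mulOp_apply, Fin.sum_univ_two]
  refine closure_mem_affiliated hτ hT.2.1 (isAff_ampGraph hT)
    !![1, 0; 0, c • 1] (fun v hv hv0 => ?_) (fun x y => ?_)
  · rw [h0] at hv0
    ext i
    fin_cases i
    · exact hv0
    · exact T.graph_fst_eq_zero_snd hv hv0
  · rw [mem_graph_smul]
    constructor
    · rintro ⟨z, hz, rfl⟩
      exact ⟨WithLp.toLp 2 ![x, z], hz, h0 _, h1 _⟩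
    · rintro ⟨v, hv, rfl, rfl⟩
      rw [h0, h1]
      exact ⟨v 1, hv, rfl⟩

end Operations

section Ring

variable {M : VonNeumannAlgebra H} {τ : M.toStarSubalgebra →ₗ[ℂ] ℂ}

/-- The algebra of operators affiliated with `M`. The tracial state is only recorded in order to
make the ring structure, which depends on its existence, an instance. -/
def Aff (_hτ : IsTracialState M τ) : Type _ := {T : H →ₗ.[ℂ] H // T ∈ affiliated M}

variable {hτ : IsTracialState M τ}

namespace Aff

/-- The underlying unbounded operator. -/
def op (T : Aff hτ) : H →ₗ.[ℂ] H := T.1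

theorem op_mem (T : Aff hτ) : T.op ∈ affiliated M := T.2

theorem op_injective : Function.Injective (op : Aff hτ → H →ₗ.[ℂ] H) := Subtype.val_injective

/-- Two affiliated operators with the same value on an injective element of `M` are equal. -/
theorem ext_sends {S T : Aff hτ} {b a : M.toStarSubalgebra} (hb : ElemInj b)
    (h : Sends S.op b a) (h' : Sends T.op b a) : S = T :=
  op_injective (h.ext hτ S.2 T.2 hb h')

theorem exists_sends (T : Aff hτ) (c : M.toStarSubalgebra) :
    ∃ e a : M.toStarSubalgebra, ElemInj e ∧ Sends T.op (c * e) a :=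
  exists_sends_mul hτ T.2 c

instance : Zero (Aff hτ) := ⟨⟨0, zero_mem_affiliated⟩⟩
instance : One (Aff hτ) := ⟨⟨sOne, sOne_mem_affiliated⟩⟩
instance : Add (Aff hτ) := ⟨fun S T => ⟨sAdd S.op T.op, sAdd_mem_affiliated hτ S.2 T.2⟩⟩
instance : Mul (Aff hτ) := ⟨fun S T => ⟨sMul S.op T.op, sMul_mem_affiliated hτ S.2 T.2⟩⟩
instance : Neg (Aff hτ) := ⟨fun T => ⟨sSMul (-1) T.op, sSMul_mem_affiliated hτ _ T.2⟩⟩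

theorem op_zero : (0 : Aff hτ).op = 0 := rfl
theorem op_one : (1 : Aff hτ).op = sOne := rfl
theorem op_add (S T : Aff hτ) : (S + T).op = sAdd S.op T.op := rfl
theorem op_mul (S T : Aff hτ) : (S * T).op = sMul S.op T.op := rfl

theorem sends_add {S T : Aff hτ} {b a c : M.toStarSubalgebra} (h : Sends S.op b a)
    (h' : Sends T.op b c) : Sends (S + T).op b (a + c) := h.sAdd h'

theorem sends_mul {S T : Aff hτ} {b a c : M.toStarSubalgebra} (h : Sends T.op b a)
    (h' : Sends S.op a c) : Sends (S * T).op b c := h.sMul h'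

theorem sends_neg {T : Aff hτ} {b a : M.toStarSubalgebra} (h : Sends T.op b a) :
    Sends (-T).op b (-a) := by
  have := h.sSMul (-1)
  rwa [neg_one_smul] at this

/-- The values of two affiliated operators on a common injective element of `M`. -/
theorem exists_sends₂ (S T : Aff hτ) : ∃ b a c : M.toStarSubalgebra,
    ElemInj b ∧ Sends S.op b a ∧ Sends T.op b c := by
  obtain ⟨e, a, he, ha⟩ := S.exists_sends 1
  obtain ⟨f, c, hf, hc⟩ := T.exists_sends e
  rw [one_mul] at ha
  exact ⟨e * f, a * f, c, he.mul hf, ha.mul_right f, hc⟩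

/-- The values of three affiliated operators on a common injective element of `M`. -/
theorem exists_sends₃ (S T U : Aff hτ) : ∃ b a c d : M.toStarSubalgebra,
    ElemInj b ∧ Sends S.op b a ∧ Sends T.op b c ∧ Sends U.op b d := by
  obtain ⟨b, a, c, hb, ha, hc⟩ := exists_sends₂ S T
  obtain ⟨f, d, hf, hd⟩ := U.exists_sends b
  exact ⟨b * f, a * f, c * f, d, hb.mul hf, ha.mul_right f, hc.mul_right f, hd⟩

instance : Ring (Aff hτ) where
  add_assoc S T U := by
    obtain ⟨b, a, c, d, hb, ha, hc, hd⟩ := exists_sends₃ S T U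
    refine ext_sends hb (sends_add (sends_add ha hc) hd) ?_
    rw [add_assoc]
    exact sends_add ha (sends_add hc hd)
  zero_add T := by
    obtain ⟨b, a, hb, ha⟩ := T.exists_sends 1
    refine ext_sends (elemInj_one.mul hb) (sends_add (sends_zero _) ha) ?_
    rwa [zero_add]
  add_zero T := by
    obtain ⟨b, a, hb, ha⟩ := T.exists_sends 1
    refine ext_sends (elemInj_one.mul hb) (sends_add ha (sends_zero _)) ?_
    rwa [add_zero]
  add_comm S T := by
    obtain ⟨b, a, c, hb, ha, hc⟩ := exists_sends₂ S T
    refine ext_sends hb (sends_add ha hc) ?_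
    rw [add_comm]
    exact sends_add hc ha
  nsmul := nsmulRec
  zsmul := zsmulRec
  neg_add_cancel T := by
    obtain ⟨b, a, hb, ha⟩ := T.exists_sends 1
    refine ext_sends (elemInj_one.mul hb) (sends_add (sends_neg ha) ha) ?_
    rw [neg_add_cancel]
    exact sends_zero _
  mul_assoc S T U := by
    obtain ⟨b, a, hb, ha⟩ := U.exists_sends 1
    obtain ⟨e, c, he, hc⟩ := T.exists_sends a
    obtain ⟨f, d, hf, hd⟩ := S.exists_sends c
    have h1 := (ha.mul_right e).mul_right f
    have h2 := hc.mul_right f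
    exact ext_sends (((elemInj_one.mul hb).mul he).mul hf)
      (sends_mul h1 (sends_mul h2 hd)) (sends_mul (sends_mul h1 h2) hd)
  one_mul T := by
    obtain ⟨b, a, hb, ha⟩ := T.exists_sends 1
    exact ext_sends (elemInj_one.mul hb) (sends_mul ha (sends_one _)) ha
  mul_one T := by
    obtain ⟨b, a, hb, ha⟩ := T.exists_sends 1
    exact ext_sends (elemInj_one.mul hb) (sends_mul (sends_one _) ha) ha
  zero_mul T := by
    obtain ⟨b, a, hb, ha⟩ := T.exists_sends 1
    exact ext_sends (elemInj_one.mul hb) (sends_mul ha (sends_zero _)) (sends_zero _)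
  mul_zero T := by
    refine ext_sends elemInj_one (sends_mul (sends_zero _) (fun x => ?_)) (sends_zero _)
    exact T.op.graph.zero_mem
  left_distrib S T U := by
    obtain ⟨b, a, c, hb, ha, hc⟩ := exists_sends₂ T U
    obtain ⟨e, d, he, hd⟩ := S.exists_sends a
    obtain ⟨f, g, hf, hg⟩ := S.exists_sends (c * e)
    have h1 := (ha.mul_right e).mul_right f
    have h2 := (hc.mul_right e).mul_right f
    have h3 := hd.mul_right f
    refine ext_sends ((hb.mul he).mul hf) (sends_mul (sends_add h1 h2) (a := a * e * f + c * e * f)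
      (c := d * f + g) fun x => ?_) (sends_add (sends_mul h1 h3) (sends_mul h2 hg))
    exact S.op.graph.add_mem (h3 x) (hg x)
  right_distrib S T U := by
    obtain ⟨b, a, hb, ha⟩ := U.exists_sends 1
    obtain ⟨e, d, he, hd⟩ := S.exists_sends a
    obtain ⟨f, g, hf, hg⟩ := T.exists_sends (a * e)
    have h1 := (ha.mul_right e).mul_right f
    have h3 := hd.mul_right f
    exact ext_sends (((elemInj_one.mul hb).mul he).mul hf) (sends_mul h1 (sends_add h3 hg))
      (sends_add (sends_mul h1 h3) (sends_mul h1 hg))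

/-- The inclusion of `M` into the algebra of affiliated operators. -/
def incl (hτ : IsTracialState M τ) : M.toStarSubalgebra →+* Aff hτ where
  toFun a := ⟨ofBounded (a : H →L[ℂ] H), ofBounded_mem_affiliated a⟩
  map_one' := rfl
  map_zero' := op_injective ofBounded_zero
  map_add' a b := by
    have h := sends_add (hτ := hτ) (S := ⟨_, ofBounded_mem_affiliated a⟩)
      (T := ⟨_, ofBounded_mem_affiliated b⟩) (sends_ofBounded a 1) (sends_ofBounded b 1)
    rw [← add_mul] at h
    exact ext_sends elemInj_one (sends_ofBounded _ _) h
  map_mul' a b := by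
    have h := sends_mul (hτ := hτ) (T := ⟨_, ofBounded_mem_affiliated b⟩)
      (S := ⟨_, ofBounded_mem_affiliated a⟩) (sends_ofBounded b 1) (sends_ofBounded a _)
    rw [← mul_assoc] at h
    exact ext_sends elemInj_one (sends_ofBounded _ _) h

theorem sends_incl (a b : M.toStarSubalgebra) : Sends (incl hτ a).op b (a * b) :=
  sends_ofBounded a b

theorem incl_injective : Function.Injective (incl hτ) := by
  intro a b h
  have h1 := sends_incl (hτ := hτ) a 1
  rw [h] at h1
  simpa using h1.unique (sends_incl b 1)

theorem mul_incl_eq {T : Aff hτ} {b a : M.toStarSubalgebra} (h : Sends T.op b a) :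
    T * incl hτ b = incl hτ a := by
  have h1 := sends_incl (hτ := hτ) b 1
  have h2 := sends_incl (hτ := hτ) a 1
  rw [mul_one] at h1 h2
  exact ext_sends elemInj_one (sends_mul h1 h) h2

/-- Injective elements of `M` are invertible among the affiliated operators: the graph of the
inverse is the flipped graph, and its domain is dense since injective elements have dense range. -/
theorem isUnit_incl {b : M.toStarSubalgebra} (hb : ElemInj b) : IsUnit (incl hτ b) := by
  have hker : LinearMap.ker (ofBounded (b : H →L[ℂ] H)).toFun = ⊥ :=
    (Submodule.eq_bot_iff _).2 fun v hv => Subtype.ext (hb v hv)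
  let I : H →ₗ.[ℂ] H := (ofBounded (b : H →L[ℂ] H)).inverse
  have hgraph : ∀ x y, (x, y) ∈ I.graph ↔ (b : H →L[ℂ] H) y = x := by
    intro x y
    rw [LinearPMap.inverse_graph hker, ← mem_graph_ofBounded, Submodule.mem_map]
    constructor
    · rintro ⟨p, hp, h⟩
      have h2 : p = (y, x) := by rw [← Prod.swap_swap p]; exact congrArg Prod.swap h
      rwa [h2] at hp
    · intro h; exact ⟨(y, x), h, rfl⟩
  have hsends : Sends I b 1 := fun x => (hgraph _ _).2 rfl
  have hI : I ∈ affiliated M := by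
    rw [mem_affiliated_iff]
    refine ⟨?_, hsends.dense_domain hτ hb, fun g hg x y hxy => ?_⟩
    · have : (I.graph : Set (H × H)) = {p | (b : H →L[ℂ] H) p.2 = p.1} := by
        ext ⟨x, y⟩; exact hgraph x y
      rw [LinearPMap.IsClosed, this]
      exact isClosed_eq ((b : H →L[ℂ] H).continuous.comp continuous_snd) continuous_fst
    · rw [hgraph] at hxy ⊢
      rw [← hxy]
      exact (congrArg (fun f : H →L[ℂ] H => f y)
        (VonNeumannAlgebra.mem_commutant_iff.1 hg b b.2))
  obtain ⟨J, hJ⟩ : ∃ J : Aff hτ, J.op = I := ⟨⟨I, hI⟩, rfl⟩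
  rw [← hJ] at hsends
  have h1 : J * incl hτ b = 1 := by
    rw [mul_incl_eq hsends, map_one]
  have h2 : incl hτ b * J = 1 := by
    have h3 := sends_incl (hτ := hτ) b 1
    rw [mul_one] at h3
    exact ext_sends hb (sends_mul hsends h3) (sends_one b)
  exact isUnit_iff_exists.2 ⟨J, h2, h1⟩

end Aff

end Ring

/-! ### Matrices over division rings -/

section DivisionRing

open Module

variable {K : Type*} [DivisionRing K] {ι κ : Type*} [Fintype ι] [Fintype κ] [DecidableEq ι]
  [DecidableEq κ]

theorem exists_left_inverse_of_vecMul_injective (P : Matrix ι ι K)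
    (h : ∀ x, Matrix.vecMul x P = 0 → x = 0) : ∃ Q : Matrix ι ι K, Q * P = 1 := by
  have hinj : Function.Injective P.toLinearMapRight' := by
    rw [← LinearMap.ker_eq_bot, LinearMap.ker_eq_bot']
    exact h
  have hsurj := LinearMap.injective_iff_surjective.1 hinj
  choose q hq using fun i => hsurj ((1 : Matrix ι ι K) i)
  exact ⟨Matrix.of q, by ext i j; exact congrFun (hq i) j⟩

/-- Rank factorization over a division ring: the inner dimension `r` is the dimension of the row
space, and the identity matrix of size `r` factors through the given matrix. -/
theorem exists_rank_factorization (P : Matrix κ ι K) :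
    ∃ (r : ℕ) (B : Matrix κ (Fin r) K) (C : Matrix (Fin r) ι K) (L : Matrix (Fin r) κ K)
      (R : Matrix ι (Fin r) K), P = B * C ∧ L * P * R = 1 := by
  let f := P.toLinearMapRight'
  let r := finrank K (LinearMap.range f)
  let e : LinearMap.range f ≃ₗ[K] (Fin r → K) := (finBasis K (LinearMap.range f)).equivFun
  let p : (κ → K) →ₗ[K] (Fin r → K) := e.toLinearMap ∘ₗ f.rangeRestrict
  let q : (Fin r → K) →ₗ[K] (ι → K) := (LinearMap.range f).subtype ∘ₗ e.symm.toLinearMap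
  have hf : f = q ∘ₗ p := by
    refine LinearMap.ext fun x => ?_
    simp [p, q]
  obtain ⟨s, hs⟩ := p.exists_rightInverse_of_surjective (by
    rw [LinearMap.range_eq_top]
    exact e.surjective.comp f.surjective_rangeRestrict)
  obtain ⟨t, ht⟩ := q.exists_leftInverse_of_injective (by
    rw [LinearMap.ker_eq_bot]
    exact Subtype.val_injective.comp e.symm.injective)
  have hP : P = LinearMap.toMatrixRight' p * LinearMap.toMatrixRight' q := by
    rw [← LinearMap.toMatrixRight'_comp, ← hf]
    exact (LinearMap.toMatrixRight'.apply_symm_apply P).symm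
  refine ⟨r, LinearMap.toMatrixRight' p, LinearMap.toMatrixRight' q, LinearMap.toMatrixRight' s,
    LinearMap.toMatrixRight' t, hP, ?_⟩
  rw [hP, ← LinearMap.toMatrixRight'_comp, ← LinearMap.toMatrixRight'_comp,
    ← LinearMap.toMatrixRight'_comp, LinearMap.comp_assoc, hs, LinearMap.comp_id, ht,
    LinearMap.toMatrixRight'_id]

end DivisionRing

section Subrings

variable {A : Type*} [Ring A]

/-- Every nonzero element of the subring `D` has an inverse in `D`. -/
def HasInverses (D : Subring A) : Prop := ∀ d ∈ D, d ≠ 0 → ∃ d' ∈ D, d * d' = 1 ∧ d' * d = 1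

/-- A subring with inverses, as a division ring. -/
abbrev HasInverses.divisionRing [Nontrivial A] {D : Subring A} (hD : HasInverses D) :
    DivisionRing D :=
  DivisionRing.ofIsUnitOrEqZero fun d => by
    by_cases h : d = 0
    · exact Or.inr h
    · obtain ⟨d', hd', h1, h2⟩ := hD d d.2 fun h' => h (Subtype.ext h')
      exact Or.inl (isUnit_iff_exists.2 ⟨⟨d', hd'⟩, Subtype.ext h1, Subtype.ext h2⟩)

/-- The matrix has all entries in the subring. -/
def MatIn {ι κ : Type*} (D : Subring A) (P : Matrix ι κ A) : Prop := ∀ i j, P i j ∈ D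

theorem MatIn.exists_map {ι κ : Type*} {D : Subring A} {P : Matrix ι κ A} (h : MatIn D P) :
    ∃ P' : Matrix ι κ D, P'.map D.subtype = P :=
  ⟨Matrix.of fun i j => ⟨P i j, h i j⟩, rfl⟩

theorem matIn_map {ι κ : Type*} {D : Subring A} (P : Matrix ι κ D) : MatIn D (P.map D.subtype) :=
  fun i j => (P i j).2

variable {ι κ l : Type*} [Fintype ι] [Fintype κ] [Fintype l] [DecidableEq ι] [DecidableEq κ]
  [DecidableEq l]

theorem MatIn.mul {D : Subring A} {P : Matrix l ι A} {Q : Matrix ι κ A} (hP : MatIn D P)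
    (hQ : MatIn D Q) : MatIn D (P * Q) := fun i j => by
  rw [Matrix.mul_apply]
  exact D.sum_mem fun k _ => D.mul_mem (hP i k) (hQ k j)

theorem MatIn.one {D : Subring A} : MatIn D (1 : Matrix ι ι A) := fun i j => by
  rw [Matrix.one_apply]
  split_ifs
  exacts [D.one_mem, D.zero_mem]

theorem MatIn.zero {D : Subring A} : MatIn D (0 : Matrix ι κ A) := fun _ _ => D.zero_mem

theorem MatIn.neg {D : Subring A} {P : Matrix ι κ A} (hP : MatIn D P) : MatIn D (-P) :=
  fun i j => D.neg_mem (hP i j)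

theorem MatIn.fromBlocks {ι' κ' : Type*} {D : Subring A} {P : Matrix ι κ A} {Q : Matrix ι κ' A}
    {R : Matrix ι' κ A} {S : Matrix ι' κ' A} (hP : MatIn D P) (hQ : MatIn D Q) (hR : MatIn D R)
    (hS : MatIn D S) : MatIn D (Matrix.fromBlocks P Q R S) := by
  rintro (i | i) (j | j)
  exacts [hP i j, hQ i j, hR i j, hS i j]

theorem MatIn.fromRows {ι' : Type*} {D : Subring A} {P : Matrix ι κ A} {Q : Matrix ι' κ A}
    (hP : MatIn D P) (hQ : MatIn D Q) : MatIn D (Matrix.fromRows P Q) := by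
  rintro (i | i) j
  exacts [hP i j, hQ i j]

theorem MatIn.fromCols {κ' : Type*} {D : Subring A} {P : Matrix ι κ A} {Q : Matrix ι κ' A}
    (hP : MatIn D P) (hQ : MatIn D Q) : MatIn D (Matrix.fromCols P Q) := by
  rintro i (j | j)
  exacts [hP i j, hQ i j]

/-- If a matrix over a subring with inverses is invertible over the whole ring, then its inverse has
entries in the subring. -/
theorem HasInverses.matIn_inverse [Nontrivial A] {D : Subring A} (hD : HasInverses D)
    {P Q : Matrix ι ι A} (hP : MatIn D P) (hPQ : P * Q = 1) : MatIn D Q := by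
  obtain ⟨P', rfl⟩ := hP.exists_map
  let _ := hD.divisionRing
  obtain ⟨Q', hQ'⟩ := exists_left_inverse_of_vecMul_injective P' fun x hx => by
    have h1 : Matrix.vecMul (fun i => (x i : A)) (P'.map D.subtype) = 0 := by
      ext j
      have := congrArg (D.subtype) (congrFun hx j)
      simpa [Matrix.vecMul, dotProduct] using this
    have h2 : (fun i => (x i : A)) = 0 := by
      rw [← Matrix.vecMul_one (fun i => (x i : A)), ← hPQ, ← Matrix.vecMul_vecMul, h1,
        Matrix.zero_vecMul]
    ext i
    exact congrFun h2 i
  have h3 : Q'.map D.subtype * P'.map D.subtype = 1 := by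
    rw [← Matrix.map_mul, hQ', Matrix.map_one _ (map_zero _) (map_one _)]
  rw [← left_inv_eq_right_inv h3 hPQ]
  exact matIn_map Q'

theorem HasInverses.exists_rank_factorization [Nontrivial A] {D : Subring A} (hD : HasInverses D)
    {P : Matrix κ ι A} (hP : MatIn D P) :
    ∃ (r : ℕ) (B : Matrix κ (Fin r) A) (C : Matrix (Fin r) ι A) (L : Matrix (Fin r) κ A)
      (R : Matrix ι (Fin r) A), MatIn D B ∧ MatIn D C ∧ P = B * C ∧ L * P * R = 1 := by
  obtain ⟨P', rfl⟩ := hP.exists_map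
  let _ := hD.divisionRing
  obtain ⟨r, B, C, L, R, h1, h2⟩ := AtiyahProperty.exists_rank_factorization P'
  refine ⟨r, B.map D.subtype, C.map D.subtype, L.map D.subtype, R.map D.subtype, matIn_map _,
    matIn_map _, ?_, ?_⟩
  · rw [← Matrix.map_mul, ← h1]
  · rw [← Matrix.map_mul, ← Matrix.map_mul, h2, Matrix.map_one _ (map_zero _) (map_one _)]

/-! ### The rational closure of a subring -/

/-- The set of entries of inverses of square matrices over the subring `S`. -/
def ratSet (S : Subring A) : Set A :=
  {t | ∃ (k : ℕ) (P Q : Matrix (Fin k) (Fin k) A), MatIn S P ∧ P * Q = 1 ∧ Q * P = 1 ∧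
    ∃ i j, Q i j = t}

variable {S : Subring A}

theorem mem_ratSet_of_inverse {P Q : Matrix ι ι A} (hP : MatIn S P) (h1 : P * Q = 1)
    (h2 : Q * P = 1) (i j : ι) : Q i j ∈ ratSet S := by
  let e := Fintype.equivFin ι
  refine ⟨Fintype.card ι, P.submatrix e.symm e.symm, Q.submatrix e.symm e.symm,
    fun i j => hP _ _, ?_, ?_, e i, e j, ?_⟩
  · rw [Matrix.submatrix_mul_equiv, h1, Matrix.submatrix_one_equiv]
  · rw [Matrix.submatrix_mul_equiv, h2, Matrix.submatrix_one_equiv]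
  · simp

/-- An element of the ring as a matrix with one entry. -/
def scal (t : A) : Matrix Unit Unit A := Matrix.of fun _ _ => t

theorem scal_add (s t : A) : scal (s + t) = scal s + scal t := rfl

theorem scal_mul (s t : A) : scal (s * t) = scal s * scal t := by
  ext i j; simp [Matrix.mul_apply, scal]

theorem scal_one : scal (1 : A) = 1 := by
  ext i j; simp [scal]

theorem scal_injective : Function.Injective (scal : A → Matrix Unit Unit A) := fun _ _ h =>
  congrFun (congrFun h ()) ()

theorem MatIn.scal {t : A} (ht : t ∈ S) : MatIn S (scal t) := fun _ _ => ht

theorem exists_scal_eq (T : Matrix Unit Unit A) : ∃ t, scal t = T := ⟨T () (), rfl⟩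

/-- A linear representation `t = u P⁻¹ v` of `t` over the subring `S`, where `Q` is the inverse of
the matrix `P`. -/
structure IsLinRep (S : Subring A) (u : Matrix Unit ι A) (P Q : Matrix ι ι A)
    (v : Matrix ι Unit A) (t : A) : Prop where
  row : MatIn S u
  mat : MatIn S P
  col : MatIn S v
  mul_inv : P * Q = 1
  inv_mul : Q * P = 1
  eq : u * Q * v = AtiyahProperty.scal t

theorem blockTriangular_mul_inverse {P Q : Matrix ι ι A} {P' Q' : Matrix κ κ A}
    (B : Matrix ι κ A) (h : P * Q = 1) (h' : P' * Q' = 1) :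
    Matrix.fromBlocks P (-B) 0 P' * Matrix.fromBlocks Q (Q * B * Q') 0 Q' = 1 := by
  rw [Matrix.fromBlocks_multiply, ← Matrix.fromBlocks_one]
  congr 1
  · simp [h]
  · simp [← Matrix.mul_assoc, h]
  · simp
  · simp [h']

theorem blockTriangular_inverse_mul {P Q : Matrix ι ι A} {P' Q' : Matrix κ κ A}
    (B : Matrix ι κ A) (h : Q * P = 1) (h' : Q' * P' = 1) :
    Matrix.fromBlocks Q (Q * B * Q') 0 Q' * Matrix.fromBlocks P (-B) 0 P' = 1 := by
  rw [Matrix.fromBlocks_multiply, ← Matrix.fromBlocks_one]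
  congr 1
  · simp [h]
  · simp [Matrix.mul_assoc, h']
  · simp
  · simp [h']

/-- The element `u P⁻¹ v` is the corner entry of the inverse of the block triangular matrix with
diagonal blocks `1`, `P`, `1` and blocks `-u`, `-v` above the diagonal. -/
theorem IsLinRep.mem_ratSet {u : Matrix Unit ι A} {P Q : Matrix ι ι A} {v : Matrix ι Unit A} {t : A}
    (h : IsLinRep S u P Q v t) : t ∈ ratSet S := by
  have h1 := blockTriangular_mul_inverse u (mul_one (1 : Matrix Unit Unit A)) h.mul_inv
  have h1' := blockTriangular_inverse_mul u (mul_one (1 : Matrix Unit Unit A)) h.inv_mul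
  have h2 := blockTriangular_mul_inverse (Matrix.fromRows (0 : Matrix Unit Unit A) v) h1
    (mul_one (1 : Matrix Unit Unit A))
  have h2' := blockTriangular_inverse_mul (Matrix.fromRows (0 : Matrix Unit Unit A) v) h1'
    (mul_one (1 : Matrix Unit Unit A))
  have h3 := mem_ratSet_of_inverse (S := S)
    ((MatIn.one.fromBlocks h.row.neg MatIn.zero h.mat).fromBlocks (MatIn.zero.fromRows h.col).neg
      MatIn.zero MatIn.one) h2 h2' (Sum.inl (Sum.inl ())) (Sum.inr ())
  have h4 : (scal t) () () ∈ ratSet S := by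
    rw [← h.eq]
    simpa [Matrix.fromBlocks_mul_fromRows] using h3
  exact h4

theorem exists_isLinRep {t : A} (ht : t ∈ ratSet S) :
    ∃ (k : ℕ) (u : Matrix Unit (Fin k) A) (P Q : Matrix (Fin k) (Fin k) A)
      (v : Matrix (Fin k) Unit A), IsLinRep S u P Q v t := by
  obtain ⟨k, P, Q, hP, h1, h2, i, j, rfl⟩ := ht
  refine ⟨k, (1 : Matrix (Fin k) (Fin k) A).submatrix (fun _ => i) id, P, Q,
    (1 : Matrix (Fin k) (Fin k) A).submatrix id (fun _ => j), fun _ _ => MatIn.one _ _, hP,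
    fun _ _ => MatIn.one _ _, h1, h2, ?_⟩
  ext a b
  simp [Matrix.mul_apply, Matrix.one_apply, scal]

theorem isLinRep_of_mem {s : A} (hs : s ∈ S) : IsLinRep S (scal s) 1 1 1 s :=
  ⟨MatIn.scal hs, MatIn.one, MatIn.one, mul_one _, mul_one _, by simp⟩

theorem IsLinRep.add {u : Matrix Unit ι A} {P Q : Matrix ι ι A} {v : Matrix ι Unit A} {t : A}
    {u' : Matrix Unit κ A} {P' Q' : Matrix κ κ A} {v' : Matrix κ Unit A} {t' : A}
    (h : IsLinRep S u P Q v t) (h' : IsLinRep S u' P' Q' v' t') :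
    IsLinRep S (Matrix.fromCols u u') (Matrix.fromBlocks P 0 0 P') (Matrix.fromBlocks Q 0 0 Q')
      (Matrix.fromRows v v') (t + t') where
  row := h.row.fromCols h'.row
  mat := h.mat.fromBlocks MatIn.zero MatIn.zero h'.mat
  col := h.col.fromRows h'.col
  mul_inv := by simp [Matrix.fromBlocks_multiply, h.mul_inv, h'.mul_inv]
  inv_mul := by simp [Matrix.fromBlocks_multiply, h.inv_mul, h'.inv_mul]
  eq := by
    rw [Matrix.fromCols_mul_fromBlocks, Matrix.fromCols_mul_fromRows, scal_add, ← h.eq, ← h'.eq]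
    simp

theorem IsLinRep.neg {u : Matrix Unit ι A} {P Q : Matrix ι ι A} {v : Matrix ι Unit A} {t : A}
    (h : IsLinRep S u P Q v t) : IsLinRep S (-u) P Q v (-t) :=
  ⟨h.row.neg, h.mat, h.col, h.mul_inv, h.inv_mul, by
    rw [Matrix.neg_mul, Matrix.neg_mul, h.eq]; rfl⟩

theorem IsLinRep.mul {u : Matrix Unit ι A} {P Q : Matrix ι ι A} {v : Matrix ι Unit A} {t : A}
    {u' : Matrix Unit κ A} {P' Q' : Matrix κ κ A} {v' : Matrix κ Unit A} {t' : A}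
    (h : IsLinRep S u P Q v t) (h' : IsLinRep S u' P' Q' v' t') :
    IsLinRep S (Matrix.fromCols u 0) (Matrix.fromBlocks P (-(v * u')) 0 P')
      (Matrix.fromBlocks Q (Q * (v * u') * Q') 0 Q') (Matrix.fromRows 0 v') (t * t') where
  row := h.row.fromCols MatIn.zero
  mat := h.mat.fromBlocks (h.col.mul h'.row).neg MatIn.zero h'.mat
  col := MatIn.zero.fromRows h'.col
  mul_inv := blockTriangular_mul_inverse _ h.mul_inv h'.mul_inv
  inv_mul := blockTriangular_inverse_mul _ h.inv_mul h'.inv_mul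
  eq := by
    rw [Matrix.fromCols_mul_fromBlocks, Matrix.fromCols_mul_fromRows, scal_mul, ← h.eq, ← h'.eq]
    simp [Matrix.mul_assoc]

/-- The bordered matrix of a linear representation of an invertible element is invertible. -/
theorem IsLinRep.bordered_inverse {u : Matrix Unit ι A} {P Q : Matrix ι ι A} {v : Matrix ι Unit A}
    {t t' : A} (h : IsLinRep S u P Q v t) (ht : t * t' = 1) (ht' : t' * t = 1) :
    Matrix.fromBlocks P v u 0 *
      Matrix.fromBlocks (Q - Q * v * scal t' * u * Q) (Q * v * scal t') (scal t' * u * Q)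
        (-scal t') = 1 ∧
    Matrix.fromBlocks (Q - Q * v * scal t' * u * Q) (Q * v * scal t') (scal t' * u * Q)
        (-scal t') * Matrix.fromBlocks P v u 0 = 1 := by
  have e1 : u * (Q * v) = scal t := by rw [← Matrix.mul_assoc, h.eq]
  have e2 : ∀ X : Matrix Unit ι A, u * (Q * (v * X)) = scal t * X := fun X => by
    rw [← e1, Matrix.mul_assoc, Matrix.mul_assoc]
  have e2' : ∀ X : Matrix Unit Unit A, u * (Q * (v * X)) = scal t * X := fun X => by
    rw [← e1, Matrix.mul_assoc, Matrix.mul_assoc]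
  have e3 : scal t * scal t' = 1 := by rw [← scal_mul, ht, scal_one]
  have e4 : scal t' * scal t = 1 := by rw [← scal_mul, ht', scal_one]
  have e5 : ∀ X : Matrix Unit ι A, scal t * (scal t' * X) = X := fun X => by
    rw [← Matrix.mul_assoc, e3, Matrix.one_mul]
  have e6 : ∀ X : Matrix ι ι A, P * (Q * X) = X := fun X => by
    rw [← Matrix.mul_assoc, h.mul_inv, Matrix.one_mul]
  have e6' : ∀ X : Matrix ι Unit A, P * (Q * X) = X := fun X => by
    rw [← Matrix.mul_assoc, h.mul_inv, Matrix.one_mul]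
  constructor
  · rw [Matrix.fromBlocks_multiply, ← Matrix.fromBlocks_one]
    congr 1
    · simp [Matrix.mul_sub, Matrix.mul_assoc, h.mul_inv, e6]
    · simp [Matrix.mul_assoc, e6']
    · simp [Matrix.mul_sub, Matrix.mul_assoc, e2, e5]
    · simp [Matrix.mul_assoc, e2', e3]
  · rw [Matrix.fromBlocks_multiply, ← Matrix.fromBlocks_one]
    congr 1
    · simp [Matrix.sub_mul, Matrix.mul_assoc, h.inv_mul]
    · simp [Matrix.sub_mul, Matrix.mul_assoc, e1, e4]
    · simp [Matrix.mul_assoc, h.inv_mul]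
    · simp [Matrix.mul_assoc, e1, e4]

/-- The rational closure is closed under inverses: the inverse of `t` is, up to sign, an entry of
the inverse of a bordered matrix. -/
theorem inverse_mem_ratSet {t t' : A} (ht : t ∈ ratSet S) (h1 : t * t' = 1) (h2 : t' * t = 1) :
    t' ∈ ratSet S := by
  obtain ⟨k, u, P, Q, v, h⟩ := exists_isLinRep ht
  obtain ⟨h3, h4⟩ := h.bordered_inverse h1 h2
  have h5 := mem_ratSet_of_inverse (h.mat.fromBlocks h.col h.row MatIn.zero) h3 h4 (Sum.inr ())
    (Sum.inr ())
  obtain ⟨k, u, P, Q, v, h'⟩ := exists_isLinRep h5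
  have h6 := h'.neg.mem_ratSet
  simpa [scal] using h6

/-- The rational closure of a subring is a subring. -/
def ratSubring (S : Subring A) : Subring A where
  carrier := ratSet S
  mul_mem' hs ht := by
    obtain ⟨_, _, _, _, _, h⟩ := exists_isLinRep hs
    obtain ⟨_, _, _, _, _, h'⟩ := exists_isLinRep ht
    exact (h.mul h').mem_ratSet
  one_mem' := (isLinRep_of_mem S.one_mem).mem_ratSet
  add_mem' hs ht := by
    obtain ⟨_, _, _, _, _, h⟩ := exists_isLinRep hs
    obtain ⟨_, _, _, _, _, h'⟩ := exists_isLinRep ht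
    exact (h.add h').mem_ratSet
  zero_mem' := (isLinRep_of_mem S.zero_mem).mem_ratSet
  neg_mem' hs := by
    obtain ⟨_, _, _, _, _, h⟩ := exists_isLinRep hs
    exact h.neg.mem_ratSet

theorem le_ratSubring : S ≤ ratSubring S := fun _ hs => (isLinRep_of_mem hs).mem_ratSet

/-- If the bordered matrix of a linear representation of `t` is invertible, then so is `t`. -/
theorem IsLinRep.isUnit_of_bordered {u : Matrix Unit ι A} {P Q : Matrix ι ι A}
    {v : Matrix ι Unit A} {t : A} (h : IsLinRep S u P Q v t)
    {B : Matrix (ι ⊕ Unit) (ι ⊕ Unit) A} (h1 : Matrix.fromBlocks P v u 0 * B = 1)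
    (h2 : B * Matrix.fromBlocks P v u 0 = 1) : ∃ t', t * t' = 1 ∧ t' * t = 1 := by
  rw [← Matrix.fromBlocks_toBlocks B, Matrix.fromBlocks_multiply, ← Matrix.fromBlocks_one,
    Matrix.fromBlocks_inj] at h1 h2
  obtain ⟨-, h12, -, h22⟩ := h1
  obtain ⟨-, -, g21, g22⟩ := h2
  obtain ⟨s, hs⟩ := exists_scal_eq B.toBlocks₂₂
  rw [← hs] at h12 g21
  rw [Matrix.zero_mul, add_zero] at h22
  rw [Matrix.mul_zero, add_zero] at g22
  have e1 : B.toBlocks₁₂ = -(Q * v * scal s) := by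
    rw [eq_neg_iff_add_eq_zero, Matrix.mul_assoc, ← Matrix.one_mul B.toBlocks₁₂, ← h.inv_mul,
      Matrix.mul_assoc, ← Matrix.mul_add, h12, Matrix.mul_zero]
  have e2 : B.toBlocks₂₁ = -(scal s * u * Q) := by
    rw [eq_neg_iff_add_eq_zero, ← Matrix.mul_one B.toBlocks₂₁, ← h.mul_inv,
      ← Matrix.mul_assoc, ← Matrix.add_mul, g21, Matrix.zero_mul]
  refine ⟨-s, scal_injective ?_, scal_injective ?_⟩
  · rw [e1, Matrix.mul_neg, ← Matrix.mul_assoc, ← Matrix.mul_assoc, h.eq, ← scal_mul] at h22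
    rw [mul_neg, scal_one, ← h22]
    rfl
  · rw [e2, Matrix.neg_mul, Matrix.mul_assoc, Matrix.mul_assoc, ← Matrix.mul_assoc u, h.eq,
      ← scal_mul] at g22
    rw [neg_mul, scal_one, ← g22]
    rfl

/-- Over a ring with Dedekind-finite matrix rings, a factorization of the bordered matrix
of `t` through a smaller dimension forces `t = 0`. -/
theorem IsLinRep.eq_zero_of_factorization [IsDedekindFiniteMonoid (Matrix ι ι A)]
    {u : Matrix Unit ι A} {P Q : Matrix ι ι A}
    {v : Matrix ι Unit A} {t : A} (h : IsLinRep S u P Q v t) {B : Matrix (ι ⊕ Unit) κ A}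
    {C : Matrix κ (ι ⊕ Unit) A} (hBC : Matrix.fromBlocks P v u 0 = B * C)
    (hcard : Fintype.card κ ≤ Fintype.card ι) : t = 0 := by
  -- padding by zeros makes the inner index type equal to `ι`
  obtain ⟨f⟩ := Function.Embedding.nonempty_of_card_le hcard
  let E : Matrix κ ι A := (1 : Matrix ι ι A).submatrix f id
  let E' : Matrix ι κ A := (1 : Matrix ι ι A).submatrix id f
  have hE : E * E' = 1 := by
    ext a b
    simp [E, E', Matrix.mul_apply, Matrix.one_apply, f.injective.eq_iff]
  have hBC' : Matrix.fromBlocks P v u 0 = (B * E) * (E' * C) := by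
    rw [Matrix.mul_assoc, ← Matrix.mul_assoc E, hE, Matrix.one_mul, hBC]
  rw [← Matrix.fromRows_toRows (B * E), ← Matrix.fromCols_toCols (E' * C),
    Matrix.fromRows_mul_fromCols, Matrix.fromBlocks_inj] at hBC'
  obtain ⟨e1, e2, e3, e4⟩ := hBC'
  set B₁ := (B * E).toRows₁
  set B₂ := (B * E).toRows₂
  set C₁ := (E' * C).toCols₁
  set C₂ := (E' * C).toCols₂
  have f1 : B₁ * (C₁ * Q) = 1 := by rw [← Matrix.mul_assoc, ← e1, h.mul_inv]
  have f2 : C₁ * Q * B₁ = 1 := mul_eq_one_comm.1 f1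
  apply scal_injective
  rw [← h.eq, e3, e2, Matrix.mul_assoc, Matrix.mul_assoc, ← Matrix.mul_assoc Q,
    ← Matrix.mul_assoc C₁, ← Matrix.mul_assoc C₁, f2, Matrix.one_mul, ← e4]
  rfl

end Subrings

/-! ### Matrices of affiliated operators -/

section AffMatrices

variable {M : VonNeumannAlgebra H} {τ : M.toStarSubalgebra →ₗ[ℂ] ℂ} {hτ : IsTracialState M τ}
  {ι κ l : Type*} [Fintype ι] [Fintype κ] [Fintype l] [DecidableEq ι] [DecidableEq κ]
  [DecidableEq l]

/-- The inclusion of matrices over `M` into matrices over the affiliated operators. -/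
def matIncl (hτ : IsTracialState M τ) (A : Matrix κ ι M.toStarSubalgebra) :
    Matrix κ ι (Aff hτ) := A.map (Aff.incl hτ)

theorem matIncl_mul (A : Matrix κ ι M.toStarSubalgebra) (B : Matrix ι l M.toStarSubalgebra) :
    matIncl hτ (A * B) = matIncl hτ A * matIncl hτ B := Matrix.map_mul

theorem matIncl_one : matIncl hτ (1 : Matrix ι ι M.toStarSubalgebra) = 1 :=
  Matrix.map_one _ (map_zero _) (map_one _)

theorem matIncl_zero : matIncl hτ (0 : Matrix κ ι M.toStarSubalgebra) = 0 :=
  Matrix.map_zero _ (map_zero _)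

theorem matIncl_injective :
    Function.Injective (matIncl hτ : Matrix κ ι M.toStarSubalgebra → Matrix κ ι (Aff hτ)) :=
  Matrix.map_injective Aff.incl_injective

/-- The diagonal matrix with constant entry `b`. -/
def scalarMat (ι : Type*) [Fintype ι] [DecidableEq ι] (b : M.toStarSubalgebra) :
    Matrix ι ι M.toStarSubalgebra := Matrix.diagonal fun _ => b

theorem ElemInj.matInj_scalarMat {b : M.toStarSubalgebra} (hb : ElemInj b) :
    MatInj (scalarMat ι b) := by
  intro v hv
  ext i
  refine hb _ ?_
  have := congrArg (fun w : Amp H ι => w i) hv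
  simp only [mulOp_apply, scalarMat, Matrix.diagonal_apply] at this
  rw [Finset.sum_eq_single i] at this
  · simpa using this
  · intro j _ hj; rw [if_neg hj.symm]; rfl
  · simp

theorem exists_common_denominator (s : Finset ι) (T : ι → Aff hτ) :
    ∃ b : M.toStarSubalgebra, ElemInj b ∧ ∀ i ∈ s, ∃ a, Sends (T i).op b a := by
  induction s using Finset.induction_on with
  | empty => exact ⟨1, elemInj_one, by simp⟩
  | insert i s _ ih =>
    obtain ⟨b, hb, h⟩ := ih
    obtain ⟨e, a, he, ha⟩ := (T i).exists_sends b
    refine ⟨b * e, hb.mul he, fun j hj => ?_⟩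
    rcases Finset.mem_insert.1 hj with rfl | hj
    · exact ⟨a, ha⟩
    · obtain ⟨a', ha'⟩ := h j hj
      exact ⟨a' * e, ha'.mul_right e⟩

/-- The entries of a matrix of affiliated operators have a common denominator. -/
theorem exists_mul_scalarMat_eq (C : Matrix κ ι (Aff hτ)) :
    ∃ (b : M.toStarSubalgebra) (C' : Matrix κ ι M.toStarSubalgebra),
      ElemInj b ∧ C * matIncl hτ (scalarMat ι b) = matIncl hτ C' := by
  obtain ⟨b, hb, h⟩ := exists_common_denominator Finset.univ fun p : κ × ι => C p.1 p.2
  choose c hc using fun i j => h (i, j) (Finset.mem_univ _)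
  refine ⟨b, Matrix.of c, hb, ?_⟩
  ext1 i j
  have h1 : matIncl hτ (scalarMat ι b) = Matrix.diagonal fun _ => Aff.incl hτ b :=
    Matrix.diagonal_map (map_zero _)
  rw [h1, Matrix.mul_diagonal]
  exact Aff.mul_incl_eq (hc i j)

theorem eq_zero_of_mul_scalarMat {b : M.toStarSubalgebra} (hb : ElemInj b) {Y : Matrix κ ι (Aff hτ)}
    (h : Y * matIncl hτ (scalarMat ι b) = 0) : Y = 0 := by
  have h1 : matIncl hτ (scalarMat ι b) = Matrix.diagonal fun _ => Aff.incl hτ b :=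
    Matrix.diagonal_map (map_zero _)
  rw [h1] at h
  ext1 i j
  have h2 := congrFun (congrFun h i) j
  rw [Matrix.mul_diagonal] at h2
  exact (Aff.isUnit_incl hb).mul_left_eq_zero.1 h2

theorem MatInj.eq_zero_of_mul {A : Matrix κ ι M.toStarSubalgebra} (hA : MatInj A)
    {Y : Matrix ι l M.toStarSubalgebra} (h : A * Y = 0) : Y = 0 := by
  refine mulOp_injective (ContinuousLinearMap.ext fun v => ?_)
  rw [mulOp_zero]
  exact hA _ (by rw [← mulOp_mul, h, mulOp_zero])

/-- An injective matrix over `M` is left cancellable in the affiliated operators. -/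
theorem MatInj.eq_zero_of_matIncl_mul {A : Matrix κ ι M.toStarSubalgebra} (hA : MatInj A)
    {Y : Matrix ι l (Aff hτ)} (h : matIncl hτ A * Y = 0) : Y = 0 := by
  obtain ⟨b, Y', hb, hY⟩ := exists_mul_scalarMat_eq Y
  have h1 : A * Y' = 0 := matIncl_injective (hτ := hτ) (by
    rw [matIncl_mul, ← hY, ← Matrix.mul_assoc, h, Matrix.zero_mul, matIncl_zero])
  refine eq_zero_of_mul_scalarMat hb ?_
  rw [hY, hA.eq_zero_of_mul h1, matIncl_zero]

/-- A matrix over `M` is injective as soon as some left multiple of it, with coefficients in the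
affiliated operators, is an injective matrix over `M`. -/
theorem matInj_of_mul_matIncl {A : Matrix κ ι M.toStarSubalgebra} {Z : Matrix l κ (Aff hτ)}
    {D : Matrix l ι M.toStarSubalgebra} (hD : MatInj D) (h : Z * matIncl hτ A = matIncl hτ D) :
    MatInj A := by
  obtain ⟨P, hP⟩ := (isAff_ker A).exists_isProjOnto
  have h1 : A * P = 0 := mulOp_injective (ContinuousLinearMap.ext fun v => by
    rw [mulOp_mul, mulOp_zero]; exact hP.mem v)
  have h2 : D * P = 0 := matIncl_injective (hτ := hτ) (by
    rw [matIncl_mul, ← h, Matrix.mul_assoc, ← matIncl_mul, h1, matIncl_zero, matIncl_zero,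
      Matrix.mul_zero])
  intro v hv
  rw [← hP.apply v hv, hD.eq_zero_of_mul h2, mulOp_zero]

/-- Injective square matrices over `M` are invertible over the affiliated operators. -/
theorem MatInj.exists_inverse {A : Matrix ι ι M.toStarSubalgebra} (hA : MatInj A) :
    ∃ Q : Matrix ι ι (Aff hτ), matIncl hτ A * Q = 1 ∧ Q * matIncl hτ A = 1 := by
  -- the Ore condition for `A` and the `j`-th unit column gives `A w = e_j b`, and `w b⁻¹` is the
  -- `j`-th column of the inverse
  have hcol : ∀ j : ι, ∃ q : ι → Aff hτ, ∀ i,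
      ∑ k, Aff.incl hτ (A i k) * q k = (1 : Matrix ι ι (Aff hτ)) i j := by
    intro j
    obtain ⟨W, B, hB, h⟩ := hA.exists_mul_eq_mul hτ le_rfl
      (Matrix.of fun (i : ι) (_ : Fin 1) => (1 : Matrix ι ι M.toStarSubalgebra) i j)
    rw [single_eq B, matInj_single] at hB
    obtain ⟨c, hc, -⟩ := isUnit_iff_exists.1 (Aff.isUnit_incl (hτ := hτ) hB)
    refine ⟨fun k => Aff.incl hτ (W k 0) * c, fun i => ?_⟩
    have h1 := congrArg (Aff.incl hτ) (congrFun (congrFun h i) 0)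
    simp only [Matrix.mul_apply, map_sum, map_mul, Fin.sum_univ_one, Matrix.of_apply] at h1
    simp only [← mul_assoc]
    rw [← Finset.sum_mul, h1, mul_assoc, hc, mul_one, Matrix.one_apply, Matrix.one_apply]
    split_ifs
    · exact map_one _
    · exact map_zero _
  choose q hq using hcol
  have h1 : matIncl hτ A * Matrix.of (fun i j => q j i) = 1 := by
    ext1 i j
    rw [Matrix.mul_apply]
    exact hq j i
  refine ⟨_, h1, ?_⟩
  rw [← sub_eq_zero]
  refine hA.eq_zero_of_matIncl_mul ?_
  rw [Matrix.mul_sub, ← Matrix.mul_assoc, h1, Matrix.one_mul, Matrix.mul_one, sub_self]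

instance : IsDedekindFiniteMonoid (Matrix ι ι (Aff hτ)) where
  mul_eq_one_symm {B C} h := by
    obtain ⟨b, C', hb, hC⟩ := exists_mul_scalarMat_eq C
    have h1 : MatInj C' := matInj_of_mul_matIncl (hτ := hτ) (Z := B)
      (hb.matInj_scalarMat (ι := ι)) (by
        rw [← hC, ← Matrix.mul_assoc, h, Matrix.one_mul])
    obtain ⟨Q, hQ, -⟩ := h1.exists_inverse (hτ := hτ)
    rw [← hC, Matrix.mul_assoc] at hQ
    rwa [← left_inv_eq_right_inv h hQ] at hQ ⊢

/-! ### The analytic rank -/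

/-- The analytic rank of a matrix over `M`, the dimension of the closure of its range. -/
def mrank (τ : M.toStarSubalgebra →ₗ[ℂ] ℂ) (A : Matrix κ ι M.toStarSubalgebra) : ℝ :=
  vdim τ (mulOp A).range.topologicalClosure

theorem rank_eq_mrank {N : ℕ} (A : Matrix (Fin N) (Fin N) M.toStarSubalgebra) :
    rank τ A = mrank τ A := by
  have : CompleteSpace (matOp A).range.topologicalClosure :=
    (matOp A).range.isClosed_topologicalClosure.completeSpace_coe
  have hP : IsProjOnto (Matrix.of fun i j => (⟨opEntry (imProj A) i j, opEntry_imProj_mem A i j⟩ :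
      M.toStarSubalgebra)) (mulOp A).range.topologicalClosure := by
    obtain ⟨P, hP⟩ := (isAff_range_closure A).exists_isProjOnto
    have h1 : mulOp P = imProj A := by
      ext1 v
      refine (Submodule.eq_starProjection_of_mem_of_inner_eq_zero (hP.mem v) fun w hw => ?_).symm
      have h2 := hP.orthogonal.mem v
      rw [mulOp_sub, mulOp_one] at h2
      exact Submodule.inner_left_of_mem_orthogonal hw h2
    convert hP
    ext i j x
    rw [← mulOp_coordVec P j x i, h1]
    rfl
  rw [mrank, hP.vdim_eq, rank]
  rfl

theorem mrank_add_vdim_ker (hτ : IsTracialState M τ) (A : Matrix κ ι M.toStarSubalgebra) :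
    mrank τ A + vdim τ (mulOp A).ker = Fintype.card ι := vdim_range_add_vdim_ker hτ A

theorem mrank_le_card (hτ : IsTracialState M τ) (A : Matrix κ ι M.toStarSubalgebra) :
    mrank τ A ≤ Fintype.card ι := by
  have h1 := mrank_add_vdim_ker hτ A
  have h2 := vdim_nonneg hτ (isAff_ker A)
  linarith

theorem mrank_mul_le (hτ : IsTracialState M τ) (A : Matrix κ ι M.toStarSubalgebra)
    (B : Matrix ι l M.toStarSubalgebra) : mrank τ (A * B) ≤ mrank τ A := by
  refine vdim_mono hτ (isAff_range_closure _) (isAff_range_closure _)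
    (Submodule.topologicalClosure_mono ?_)
  rintro _ ⟨v, rfl⟩
  exact ⟨mulOp B v, (mulOp_mul A B v).symm⟩

theorem mrank_mul_of_matInj (hτ : IsTracialState M τ) (A : Matrix κ ι M.toStarSubalgebra)
    {B : Matrix ι l M.toStarSubalgebra} (hB : MatInj B) (hc : Fintype.card ι ≤ Fintype.card l) :
    mrank τ (A * B) = mrank τ A := by
  refine le_antisymm (mrank_mul_le hτ A B) (vdim_mono hτ (isAff_range_closure _)
    (isAff_range_closure _) (Submodule.topologicalClosure_minimal _ ?_
      (isAff_range_closure _).1))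
  rintro _ ⟨v, rfl⟩
  have hv : v ∈ closure ((mulOp B).range : Set (Amp H ι)) := by
    rw [← Submodule.topologicalClosure_coe, hB.range_closure_eq_top hτ hc]; trivial
  rw [← SetLike.mem_coe, Submodule.topologicalClosure_coe]
  refine map_mem_closure (mulOp A).continuous hv ?_
  rintro _ ⟨w, rfl⟩
  exact ⟨w, mulOp_mul A B w⟩

theorem mrank_matInj_mul (hτ : IsTracialState M τ) {A : Matrix κ ι M.toStarSubalgebra}
    (B : Matrix ι l M.toStarSubalgebra) (hA : MatInj A) : mrank τ (A * B) = mrank τ B := by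
  have h1 : (mulOp (A * B)).ker = (mulOp B).ker := by
    ext v
    simp only [LinearMap.mem_ker, ContinuousLinearMap.coe_coe, mulOp_mul]
    exact ⟨fun h => hA _ h, fun h => by rw [h, map_zero]⟩
  have h2 := mrank_add_vdim_ker hτ (A * B)
  have h3 := mrank_add_vdim_ker hτ B
  rw [h1] at h2
  linarith

theorem MatInj.mrank_eq (hτ : IsTracialState M τ) {A : Matrix κ ι M.toStarSubalgebra}
    (hA : MatInj A) : mrank τ A = Fintype.card ι := hA.vdim_range hτ

theorem matInj_of_mrank_eq (hτ : IsTracialState M τ) {A : Matrix κ ι M.toStarSubalgebra}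
    (h : mrank τ A = Fintype.card ι) : MatInj A := by
  have h1 := mrank_add_vdim_ker hτ A
  have h2 : ⊥ = (mulOp A).ker := eq_of_le_of_vdim_le hτ isAff_bot (isAff_ker A) bot_le (by
    rw [vdim_bot]; linarith)
  intro v hv
  have h3 : v ∈ (mulOp A).ker := hv
  rwa [← h2, Submodule.mem_bot] at h3

/-- The analytic rank does not change under a simultaneous reindexing of rows and columns. -/
theorem mrank_submatrix_equiv (hτ : IsTracialState M τ) (e : κ ≃ ι)
    (A : Matrix ι ι M.toStarSubalgebra) : mrank τ (A.submatrix e e) = mrank τ A := by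
  have hinj : ∀ (f : κ ≃ ι), MatInj ((1 : Matrix ι ι M.toStarSubalgebra).submatrix f id) ∧
      MatInj ((1 : Matrix ι ι M.toStarSubalgebra).submatrix id f) := by
    intro f
    constructor
    · refine MatInj.of_mul (A := (1 : Matrix ι ι M.toStarSubalgebra).submatrix id f) ?_
      rw [Matrix.submatrix_mul_equiv, mul_one, Matrix.submatrix_id_id]
      exact matInj_one
    · refine MatInj.of_mul (A := (1 : Matrix ι ι M.toStarSubalgebra).submatrix f id) ?_
      have := Matrix.submatrix_mul_equiv (1 : Matrix ι ι M.toStarSubalgebra) 1 f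
        (Equiv.refl ι) f
      rw [mul_one, Matrix.submatrix_one_equiv] at this
      rw [show (1 : Matrix ι ι M.toStarSubalgebra).submatrix f id *
        (1 : Matrix ι ι M.toStarSubalgebra).submatrix id f = 1 from this]
      exact matInj_one
  have h1 : A.submatrix e e = (1 : Matrix ι ι M.toStarSubalgebra).submatrix e id * A *
      (1 : Matrix ι ι M.toStarSubalgebra).submatrix id e := by
    ext1 i j
    simp [Matrix.mul_apply, Matrix.one_apply]
  rw [h1, mrank_mul_of_matInj hτ _ (hinj e).2 (Fintype.card_congr e).symm.le,
    mrank_matInj_mul hτ _ (hinj e).1]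

/-- A factorization over the affiliated operators bounds the analytic rank. -/
theorem mrank_le_of_factorization {A : Matrix κ ι M.toStarSubalgebra} {B : Matrix κ l (Aff hτ)}
    {C : Matrix l ι (Aff hτ)} (h : matIncl hτ A = B * C) : mrank τ A ≤ Fintype.card l := by
  obtain ⟨b, C', hb, hC⟩ := exists_mul_scalarMat_eq C
  obtain ⟨b', B', hb', hB⟩ := exists_mul_scalarMat_eq B
  obtain ⟨W, D, hD, hW⟩ := (hb'.matInj_scalarMat (ι := l)).exists_mul_eq_mul hτ le_rfl C'
  have hW' := congrArg (matIncl hτ) hW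
  rw [matIncl_mul, matIncl_mul] at hW'
  have h1 : A * (scalarMat ι b * D) = B' * W := matIncl_injective (hτ := hτ) (by
    rw [matIncl_mul, matIncl_mul, matIncl_mul, h, ← hB,
      Matrix.mul_assoc B (matIncl hτ _) (matIncl hτ _), hW', ← hC]
    simp only [Matrix.mul_assoc])
  rw [← mrank_mul_of_matInj hτ A ((hb.matInj_scalarMat).mul hD) le_rfl, h1]
  exact (mrank_mul_le hτ B' W).trans (mrank_le_card hτ B')

/-- An identity matrix that factors through `A` over the affiliated operators bounds the analytic
rank of `A` from below. -/
theorem card_le_mrank {A : Matrix κ ι M.toStarSubalgebra} {L : Matrix l κ (Aff hτ)}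
    {R : Matrix ι l (Aff hτ)} (h : L * matIncl hτ A * R = 1) :
    (Fintype.card l : ℝ) ≤ mrank τ A := by
  obtain ⟨b, R', hb, hR⟩ := exists_mul_scalarMat_eq R
  have h1 : MatInj (A * R') := matInj_of_mul_matIncl (hτ := hτ) (Z := L)
    (hb.matInj_scalarMat (ι := l)) (by
      rw [matIncl_mul, ← hR, ← Matrix.mul_assoc, ← Matrix.mul_assoc, h, Matrix.one_mul])
  rw [← h1.mrank_eq hτ]
  exact mrank_mul_le hτ A R'

/-- The coordinates of a vector in the first summand. -/
def leftPart (v : Amp H (ι ⊕ κ)) : Amp H ι := WithLp.toLp 2 fun i => v (Sum.inl i)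

/-- The coordinates of a vector in the second summand. -/
def rightPart (v : Amp H (ι ⊕ κ)) : Amp H κ := WithLp.toLp 2 fun i => v (Sum.inr i)

theorem eq_zero_of_leftPart_of_rightPart {v : Amp H (ι ⊕ κ)} (h : leftPart v = 0)
    (h' : rightPart v = 0) : v = 0 := by
  ext (i | i)
  · exact congrArg (fun w : Amp H ι => w i) h
  · exact congrArg (fun w : Amp H κ => w i) h'

theorem leftPart_mulOp_fromBlocks {ι' κ' : Type*} [Fintype ι'] [Fintype κ'] [DecidableEq ι']
    [DecidableEq κ'] (A : Matrix ι' ι M.toStarSubalgebra) (B : Matrix ι' κ M.toStarSubalgebra)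
    (C : Matrix κ' ι M.toStarSubalgebra) (D : Matrix κ' κ M.toStarSubalgebra) (v : Amp H (ι ⊕ κ)) :
    leftPart (mulOp (Matrix.fromBlocks A B C D) v) =
      mulOp A (leftPart v) + mulOp B (rightPart v) := by
  ext i
  simp [leftPart, rightPart, mulOp_apply]

theorem rightPart_mulOp_fromBlocks {ι' κ' : Type*} [Fintype ι'] [Fintype κ'] [DecidableEq ι']
    [DecidableEq κ'] (A : Matrix ι' ι M.toStarSubalgebra) (B : Matrix ι' κ M.toStarSubalgebra)
    (C : Matrix κ' ι M.toStarSubalgebra) (D : Matrix κ' κ M.toStarSubalgebra) (v : Amp H (ι ⊕ κ)) :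
    rightPart (mulOp (Matrix.fromBlocks A B C D) v) =
      mulOp C (leftPart v) + mulOp D (rightPart v) := by
  ext i
  simp [leftPart, rightPart, mulOp_apply]

theorem MatInj.fromBlocks {A : Matrix ι ι M.toStarSubalgebra} {D : Matrix κ κ M.toStarSubalgebra}
    (hA : MatInj A) (hD : MatInj D) (B : Matrix ι κ M.toStarSubalgebra) :
    MatInj (Matrix.fromBlocks A B 0 D) := by
  intro v hv
  have h1 := leftPart_mulOp_fromBlocks A B 0 D v
  have h2 := rightPart_mulOp_fromBlocks A B 0 D v
  rw [hv] at h1 h2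
  rw [mulOp_zero, zero_add] at h2
  have h3 := hD _ h2.symm
  rw [h3, map_zero, add_zero] at h1
  exact eq_zero_of_leftPart_of_rightPart (hA _ h1.symm) h3

/-- If the analytic rank of the bordered matrix of a linear representation of `t` is an integer,
then `t` is zero or the bordered matrix is invertible. Column operations over `M` turn the
bordered matrix into a block triangular one with diagonal blocks `P` and the numerator of `-t`, so
its kernel has dimension at most one, and dimension one only if the numerator vanishes. -/
theorem eq_zero_or_matInj_of_bordered {S : Subring (Aff hτ)} {u : Matrix Unit ι M.toStarSubalgebra}
    {P : Matrix ι ι M.toStarSubalgebra} {v : Matrix ι Unit M.toStarSubalgebra}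
    {Q : Matrix ι ι (Aff hτ)} {t : Aff hτ}
    (h : IsLinRep S (matIncl hτ u) (matIncl hτ P) Q (matIncl hτ v) t)
    {n : ℕ} (hn : mrank τ (Matrix.fromBlocks P v u 0) = n) :
    t = 0 ∨ MatInj (Matrix.fromBlocks P v u 0) := by
  have hP : MatInj P := matInj_of_mul_matIncl (hτ := hτ) (Z := Q)
    matInj_one (by rw [h.inv_mul, matIncl_one])
  obtain ⟨b, w, hb, hw⟩ := exists_mul_scalarMat_eq (Q * matIncl hτ v)
  have hPw : P * w = v * scalarMat Unit b := matIncl_injective (hτ := hτ) (by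
    rw [matIncl_mul, ← hw, ← Matrix.mul_assoc, ← Matrix.mul_assoc, h.mul_inv, Matrix.one_mul,
      matIncl_mul])
  set Y : Matrix (ι ⊕ Unit) (ι ⊕ Unit) M.toStarSubalgebra := Matrix.fromBlocks P 0 u (-(u * w))
    with hY
  let J : Matrix (ι ⊕ Unit) Unit M.toStarSubalgebra := Matrix.fromRows 0 1
  let Z : Matrix (ι ⊕ Unit) (ι ⊕ Unit) M.toStarSubalgebra :=
    Matrix.fromBlocks 1 (-w) 0 (scalarMat Unit b)
  have hfac : Matrix.fromBlocks P v u 0 * Z = Y := by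
    rw [Matrix.fromBlocks_multiply, hY]
    congr 1
    · simp
    · rw [Matrix.mul_neg, hPw, neg_add_cancel]
    · simp
    · simp
  -- the column operation `Z` is injective, hence does not change the rank
  have hYn : mrank τ Y = n := by
    rw [← hn, ← hfac]
    exact mrank_mul_of_matInj hτ _ (matInj_one.fromBlocks hb.matInj_scalarMat _) le_rfl
  have hdim := mrank_add_vdim_ker hτ Y
  rw [hYn, Fintype.card_sum, Fintype.card_unit] at hdim
  -- as `P` is injective, the kernel of `Y` lies in the last summand, which has dimension one
  have hJ : MatInj J := MatInj.of_mul (A := Matrix.fromCols 0 1) (by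
    rw [Matrix.fromCols_mul_fromRows, Matrix.zero_mul, zero_add, mul_one]
    exact matInj_one)
  have hker : (mulOp Y).ker ≤ (mulOp J).range.topologicalClosure := by
    intro x hx
    have h1 := leftPart_mulOp_fromBlocks P 0 u (-(u * w)) x
    rw [← hY, show mulOp Y x = 0 from hx, mulOp_zero, add_zero] at h1
    have h2 := hP _ h1.symm
    refine (mulOp J).range.le_topologicalClosure ⟨rightPart x, ?_⟩
    ext (i | i)
    · have h3 : x (Sum.inl i) = 0 := congrArg (fun w : Amp H ι => w i) h2
      rw [h3]
      simp [J, mulOp_apply]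
    · simp [J, mulOp_apply, rightPart]
  have hdJ := hJ.vdim_range hτ
  rw [Fintype.card_unit, Nat.cast_one] at hdJ
  have hd1 := vdim_mono hτ (isAff_ker Y) (isAff_range_closure J) hker
  have hd0 := vdim_nonneg hτ (isAff_ker Y)
  rw [hdJ] at hd1
  push_cast at hdim
  have hn1 : Fintype.card ι ≤ n := by
    have : (Fintype.card ι : ℝ) ≤ n := by linarith
    exact_mod_cast this
  have hn2 : n ≤ Fintype.card ι + 1 := by
    have : (n : ℝ) ≤ Fintype.card ι + 1 := by linarith
    exact_mod_cast this
  rcases Nat.lt_or_ge (Fintype.card ι) n with hlt | hge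
  · right
    refine matInj_of_mrank_eq hτ ?_
    rw [hn, Fintype.card_sum, Fintype.card_unit, le_antisymm hn2 hlt]
  · left
    have hnk : n = Fintype.card ι := le_antisymm hge hn1
    rw [hnk] at hdim
    -- now the kernel of `Y` is the whole last summand, so that the numerator `u w` of `t` vanishes
    have hkerJ := eq_of_le_of_vdim_le hτ (isAff_ker Y) (isAff_range_closure J) hker (by linarith)
    have hYJ : Y * J = 0 := mulOp_injective (ContinuousLinearMap.ext fun x => by
      have h1 : mulOp J x ∈ (mulOp Y).ker := by
        rw [hkerJ]; exact (mulOp J).range.le_topologicalClosure ⟨x, rfl⟩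
      rw [mulOp_mul, mulOp_zero]
      exact h1)
    rw [hY, Matrix.fromBlocks_mul_fromRows] at hYJ
    have huw : u * w = 0 := by
      have h1 := congrArg Matrix.toRows₂ hYJ
      rw [Matrix.toRows₂_fromRows, Matrix.mul_zero, zero_add, Matrix.mul_one] at h1
      exact neg_eq_zero.1 h1
    refine scal_injective (eq_zero_of_mul_scalarMat hb ?_)
    rw [← h.eq, Matrix.mul_assoc, Matrix.mul_assoc, ← Matrix.mul_assoc Q, hw, ← matIncl_mul, huw,
      matIncl_zero]

end AffMatrices

/-! ### Translation to sets of unbounded operators -/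

section Translation

variable {M : VonNeumannAlgebra H} {τ : M.toStarSubalgebra →ₗ[ℂ] ℂ} {hτ : IsTracialState M τ}

namespace Aff

theorem op_list_sum (L : List (Aff hτ)) : L.sum.op = (L.map op).foldr sAdd 0 := by
  induction L with
  | nil => rfl
  | cons T L ih => rw [List.sum_cons, op_add, ih]; rfl

theorem matMul_map_op {l m n : ℕ} (A : Matrix (Fin l) (Fin m) (Aff hτ))
    (B : Matrix (Fin m) (Fin n) (Aff hτ)) : matMul (A.map op) (B.map op) = (A * B).map op := by
  ext1 i j
  change (List.ofFn fun k => sMul (A i k).op (B k j).op).foldr sAdd 0 = ((A * B) i j).op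
  rw [Matrix.mul_apply, ← List.sum_ofFn, op_list_sum, List.map_ofFn]
  rfl

theorem matOne_eq (N : ℕ) : matOne N = (1 : Matrix (Fin N) (Fin N) (Aff hτ)).map op := by
  ext1 i j
  rw [matOne, Matrix.of_apply, Matrix.map_apply, Matrix.one_apply]
  split_ifs <;> rfl

theorem map_op_injective {ι κ : Type*} :
    Function.Injective (fun A : Matrix ι κ (Aff hτ) => A.map op) :=
  Matrix.map_injective op_injective

theorem exists_map_op_eq {m n : ℕ} {D : Set (Aff hτ)} {A : Matrix (Fin m) (Fin n) (H →ₗ.[ℂ] H)}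
    (h : EntriesIn (op '' D) A) :
    ∃ A' : Matrix (Fin m) (Fin n) (Aff hτ), (∀ i j, A' i j ∈ D) ∧ A'.map op = A := by
  choose a ha ha' using h
  exact ⟨Matrix.of a, ha, by ext1 i j; exact ha' i j⟩

variable (hτ) in
theorem exists_map_op_eq_of_affiliated {m n : ℕ} {A : Matrix (Fin m) (Fin n) (H →ₗ.[ℂ] H)}
    (h : EntriesIn (affiliated M) A) : ∃ A' : Matrix (Fin m) (Fin n) (Aff hτ), A'.map op = A :=
  ⟨Matrix.of fun i j => ⟨A i j, h i j⟩, rfl⟩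

theorem isMatInverse_map_op {N : ℕ} {A Q : Matrix (Fin N) (Fin N) (Aff hτ)} :
    IsMatInverse M (A.map op) (Q.map op) ↔ A * Q = 1 ∧ Q * A = 1 := by
  rw [IsMatInverse, matMul_map_op, matMul_map_op, matOne_eq (hτ := hτ), map_op_injective.eq_iff,
    map_op_injective.eq_iff]
  exact ⟨fun h => h.2, fun h => ⟨fun i j => (Q i j).op_mem, h⟩⟩

theorem isInverse_op {S T : Aff hτ} : IsInverse S.op T.op ↔ S * T = 1 ∧ T * S = 1 := by
  rw [IsInverse, ← op_mul, ← op_mul, ← op_one (hτ := hτ), op_injective.eq_iff, op_injective.eq_iff]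

theorem sSMul_op (c : ℂ) (T : Aff hτ) : sSMul c T.op = (incl hτ (c • 1) * T).op := by
  obtain ⟨b, a, hb, ha⟩ := T.exists_sends 1
  refine Sends.ext hτ (sSMul_mem_affiliated hτ c T.2) (op_mem _) (elemInj_one.mul hb)
    (ha.sSMul c) ?_
  have h := sends_mul ha (sends_incl (hτ := hτ) (c • 1) a)
  rwa [smul_one_mul] at h

end Aff

open Aff

theorem innerRank_map_op {N : ℕ} (D : Subring (Aff hτ)) (A : Matrix (Fin N) (Fin N) (Aff hτ)) :
    innerRank (op '' (D : Set (Aff hτ))) (A.map op) = sInf {r | ∃ (B : Matrix (Fin N) (Fin r)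
      (Aff hτ)) (C : Matrix (Fin r) (Fin N) (Aff hτ)), MatIn D B ∧ MatIn D C ∧ A = B * C} := by
  rw [innerRank]
  congr 1
  ext r
  constructor
  · rintro ⟨B, C, hB, hC, h⟩
    obtain ⟨B, hB', rfl⟩ := exists_map_op_eq hB
    obtain ⟨C, hC', rfl⟩ := exists_map_op_eq hC
    rw [matMul_map_op] at h
    exact ⟨B, C, hB', hC', map_op_injective h⟩
  · rintro ⟨B, C, hB, hC, rfl⟩
    exact ⟨B.map op, C.map op, fun i j => ⟨_, hB i j, rfl⟩, fun i j => ⟨_, hC i j, rfl⟩,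
      (matMul_map_op B C).symm⟩

theorem exists_factorization_innerRank {N : ℕ} {D : Subring (Aff hτ)}
    {A : Matrix (Fin N) (Fin N) (Aff hτ)} (hA : MatIn D A) :
    ∃ (B : Matrix (Fin N) (Fin (innerRank (op '' (D : Set (Aff hτ))) (A.map op))) (Aff hτ))
      (C : Matrix (Fin (innerRank (op '' (D : Set (Aff hτ))) (A.map op))) (Fin N) (Aff hτ)),
      MatIn D B ∧ MatIn D C ∧ A = B * C := by
  rw [innerRank_map_op]
  exact Nat.sInf_mem (s := {r | ∃ (B : Matrix (Fin N) (Fin r) (Aff hτ))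
    (C : Matrix (Fin r) (Fin N) (Aff hτ)), MatIn D B ∧ MatIn D C ∧ A = B * C})
    ⟨N, A, 1, hA, MatIn.one, (mul_one A).symm⟩

theorem innerRank_le_of_factorization {N r : ℕ} {D : Subring (Aff hτ)}
    {A : Matrix (Fin N) (Fin N) (Aff hτ)} {B : Matrix (Fin N) (Fin r) (Aff hτ)}
    {C : Matrix (Fin r) (Fin N) (Aff hτ)} (hB : MatIn D B) (hC : MatIn D C) (h : A = B * C) :
    innerRank (op '' (D : Set (Aff hτ))) (A.map op) ≤ r := by
  rw [innerRank_map_op]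
  exact Nat.sInf_le ⟨B, C, hB, hC, h⟩

theorem isDivisionRing_image_iff [Nontrivial (Aff hτ)] {D : Subring (Aff hτ)} :
    IsDivisionRing M (op '' (D : Set (Aff hτ))) ↔ HasInverses D := by
  constructor
  · rintro ⟨-, inst, h0, h1, -, hmul⟩ d hd hd0
    let x : (op '' (D : Set (Aff hτ)) : Set (H →ₗ.[ℂ] H)) := ⟨d.op, d, hd, rfl⟩
    have hx : x ≠ 0 := fun h => hd0 (op_injective (by
      rw [op_zero, ← h0, ← h]))
    obtain ⟨d', hd', he⟩ := (x⁻¹).2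
    refine ⟨d', hd', op_injective ?_, op_injective ?_⟩
    · rw [op_mul, he, op_one, ← h1, ← mul_inv_cancel₀ hx, hmul]
    · rw [op_mul, he, op_one, ← h1, ← inv_mul_cancel₀ hx, hmul]
  · intro hD
    refine ⟨by rintro _ ⟨d, -, rfl⟩; exact d.op_mem, ?_⟩
    let _ := hD.divisionRing
    let e : (op '' (D : Set (Aff hτ)) : Set (H →ₗ.[ℂ] H)) ≃ D :=
      (Equiv.Set.image op (D : Set (Aff hτ)) op_injective).symm
    have he : ∀ d : D, ((e.symm d : _) : H →ₗ.[ℂ] H) = (d : Aff hτ).op := fun _ => rfl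
    have he' : ∀ x : (op '' (D : Set (Aff hτ)) : Set (H →ₗ.[ℂ] H)),
        (x : H →ₗ.[ℂ] H) = ((e x : D) : Aff hτ).op := fun x => by
      rw [← he, e.symm_apply_apply]
    refine ⟨e.divisionRing, rfl, rfl, fun S T => ?_, fun S T => ?_⟩
    · rw [he' S, he' T]; rfl
    · rw [he' S, he' T]; rfl

end Translation

section Evaluation

variable {M : VonNeumannAlgebra H} {τ : M.toStarSubalgebra →ₗ[ℂ] ℂ} (hτ : IsTracialState M τ)
  {n : ℕ} (X : Fin n → M.toStarSubalgebra)

open Aff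

/-- Evaluation of noncommutative polynomials at `X`, with values in the affiliated operators. -/
def evAff : FreeAlgebra ℂ (Fin n) →+* Aff hτ :=
  (incl hτ).comp (FreeAlgebra.lift ℂ X : FreeAlgebra ℂ (Fin n) →ₐ[ℂ] M.toStarSubalgebra).toRingHom

theorem op_evAff (p : FreeAlgebra ℂ (Fin n)) : (evAff hτ X p).op = ev X p := rfl

theorem evMat_eq {N : ℕ} (P : Matrix (Fin N) (Fin N) (FreeAlgebra ℂ (Fin n))) :
    evMat X P = (P.map (evAff hτ X)).map op := rfl

theorem map_evAff {ι κ : Type*} [Fintype ι] [Fintype κ] [DecidableEq ι] [DecidableEq κ]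
    (P : Matrix ι κ (FreeAlgebra ℂ (Fin n))) :
    P.map (evAff hτ X) = matIncl hτ (P.map (FreeAlgebra.lift ℂ X)) := rfl

theorem matIn_map_evAff {ι κ : Type*} (P : Matrix ι κ (FreeAlgebra ℂ (Fin n))) :
    MatIn (evAff hτ X).range (P.map (evAff hτ X)) := fun _ _ => ⟨_, rfl⟩

theorem MatIn.exists_evAff {hτ : IsTracialState M τ} {X : Fin n → M.toStarSubalgebra}
    {ι κ : Type*} {P : Matrix ι κ (Aff hτ)} (h : MatIn (evAff hτ X).range P) :
    ∃ P' : Matrix ι κ (FreeAlgebra ℂ (Fin n)), P'.map (evAff hτ X) = P := by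
  choose p hp using h
  exact ⟨Matrix.of p, by ext1 i j; exact hp i j⟩

theorem rationalClosure_eq :
    rationalClosure X = op '' (ratSubring (evAff hτ X).range : Set (Aff hτ)) := by
  ext T
  constructor
  · rintro ⟨k, P, Q, hQ, i, j, rfl⟩
    obtain ⟨Q, rfl⟩ := exists_map_op_eq_of_affiliated hτ hQ.1
    rw [evMat_eq hτ, isMatInverse_map_op] at hQ
    exact ⟨Q i j, ⟨k, _, Q, matIn_map_evAff hτ X P, hQ.1, hQ.2, i, j, rfl⟩, rfl⟩
  · rintro ⟨_, ⟨k, P, Q, hP, h1, h2, i, j, rfl⟩, rfl⟩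
    obtain ⟨P, rfl⟩ := hP.exists_evAff
    refine ⟨k, P, Q.map op, ?_, i, j, rfl⟩
    rw [evMat_eq hτ, isMatInverse_map_op]
    exact ⟨h1, h2⟩

/-- The division closure is contained in every subring that contains the polynomials in `X` and is
closed under inverses. Such a subring is closed under scalar multiplication, because it contains the
scalars as constant polynomials. -/
theorem divisionClosure_subset {D : Subring (Aff hτ)} (hD : (evAff hτ X).range ≤ D)
    (hinv : ∀ d ∈ D, ∀ d', d * d' = 1 → d' * d = 1 → d' ∈ D) :
    divisionClosure X ⊆ op '' (D : Set (Aff hτ)) := by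
  refine Set.sInter_subset_of_mem ⟨⟨?_, ?_, ?_, ?_, ?_⟩, ?_, ?_⟩
  · rintro _ ⟨d, -, rfl⟩; exact d.op_mem
  · exact ⟨1, D.one_mem, rfl⟩
  · rintro _ ⟨S, hS, rfl⟩ _ ⟨T, hT, rfl⟩; exact ⟨S + T, D.add_mem hS hT, rfl⟩
  · rintro _ ⟨S, hS, rfl⟩ _ ⟨T, hT, rfl⟩; exact ⟨S * T, D.mul_mem hS hT, rfl⟩
  · rintro c _ ⟨T, hT, rfl⟩
    refine ⟨_, D.mul_mem (hD ⟨algebraMap ℂ _ c, ?_⟩) hT, (sSMul_op c T).symm⟩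
    change incl hτ (FreeAlgebra.lift ℂ X (algebraMap ℂ _ c)) = _
    rw [AlgHom.commutes, Algebra.algebraMap_eq_smul_one]
  · rintro _ ⟨p, rfl⟩
    exact ⟨evAff hτ X p, hD ⟨p, rfl⟩, rfl⟩
  · rintro _ ⟨T, hT, rfl⟩ S hS h
    obtain ⟨S, rfl⟩ : ∃ S' : Aff hτ, S'.op = S := ⟨⟨S, hS⟩, rfl⟩
    rw [isInverse_op] at h
    exact ⟨S, hinv T hT S h.1 h.2, rfl⟩

/-- The division closure as a subring of the affiliated operators. -/
def divSubring : Subring (Aff hτ) where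
  carrier := {T | T.op ∈ divisionClosure X}
  mul_mem' hS hT D hD := hD.1.mul_mem _ (hS D hD) _ (hT D hD)
  one_mem' D hD := hD.1.one_mem
  add_mem' hS hT D hD := hD.1.add_mem _ (hS D hD) _ (hT D hD)
  zero_mem' D hD := hD.2.1 ⟨0, by rw [← op_evAff hτ, map_zero, op_zero]⟩
  neg_mem' hT D hD := hD.1.smul_mem (-1) _ (hT D hD)

theorem divisionClosure_eq : divisionClosure X = op '' (divSubring hτ X : Set (Aff hτ)) := by
  ext T
  constructor
  · intro hT
    obtain ⟨T, -, rfl⟩ := divisionClosure_subset hτ X (D := ⊤) le_top (fun _ _ _ _ _ => trivial) hT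
    exact ⟨T, hT, rfl⟩
  · rintro ⟨T, hT, rfl⟩
    exact hT

theorem range_evAff_le_divSubring : (evAff hτ X).range ≤ divSubring hτ X := by
  rintro _ ⟨p, rfl⟩ D hD
  exact hD.2.1 ⟨p, rfl⟩

theorem inverse_mem_divSubring {T S : Aff hτ} (hT : T ∈ divSubring hτ X) (h1 : T * S = 1)
    (h2 : S * T = 1) : S ∈ divSubring hτ X := fun D hD =>
  hD.2.2 _ (hT D hD) _ S.op_mem (isInverse_op.2 ⟨h1, h2⟩)

theorem divSubring_le_ratSubring : divSubring hτ X ≤ ratSubring (evAff hτ X).range := by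
  intro T hT
  obtain ⟨S, hS, h⟩ := divisionClosure_subset hτ X (D := ratSubring (evAff hτ X).range)
    le_ratSubring (fun _ hd _ h1 h2 => inverse_mem_ratSet hd h1 h2) hT
  rwa [← op_injective h]

theorem nontrivial_aff : Nontrivial (Aff hτ) := by
  refine ⟨1, 0, fun h => ?_⟩
  have h1 : (1 : M.toStarSubalgebra) = 0 := incl_injective (hτ := hτ) (by rw [map_one, map_zero, h])
  have h2 := hτ.map_one
  rw [h1, map_zero] at h2
  exact zero_ne_one h2

theorem rankEv_eq {N : ℕ} (P : Matrix (Fin N) (Fin N) (FreeAlgebra ℂ (Fin n))) :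
    rankEv τ X P = mrank τ (P.map (FreeAlgebra.lift ℂ X)) := rank_eq_mrank _

/-! ### The equivalent conditions -/

theorem StrongAtiyah.exists_mrank_eq (hτ : IsTracialState M τ) {X : Fin n → M.toStarSubalgebra}
    (h : StrongAtiyah τ X) {ι : Type*} [Fintype ι] [DecidableEq ι]
    (P : Matrix ι ι (FreeAlgebra ℂ (Fin n))) :
    ∃ k : ℕ, mrank τ (P.map (FreeAlgebra.lift ℂ X)) = k := by
  let e := Fintype.equivFin ι
  obtain ⟨k, hk⟩ := h _ (P.submatrix e.symm e.symm)
  refine ⟨k, ?_⟩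
  rw [← hk, rankEv_eq, ← mrank_submatrix_equiv hτ e.symm]
  rfl

/-- Under the strong Atiyah property, the bordered matrix of a linear representation of `t ≠ 0` has
integral analytic rank, so that it is invertible, and with it `t`. -/
theorem StrongAtiyah.hasInverses {X : Fin n → M.toStarSubalgebra} (h : StrongAtiyah τ X) :
    HasInverses (ratSubring (evAff hτ X).range) := by
  intro t ht ht0
  obtain ⟨k, u, P, Q, v, hrep⟩ := exists_isLinRep ht
  obtain ⟨u, rfl⟩ := hrep.row.exists_evAff
  obtain ⟨P, rfl⟩ := hrep.mat.exists_evAff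
  obtain ⟨v, rfl⟩ := hrep.col.exists_evAff
  obtain ⟨r, hr⟩ := h.exists_mrank_eq hτ (Matrix.fromBlocks P v u 0)
  rw [Matrix.fromBlocks_map, Matrix.map_zero _ (map_zero _)] at hr
  rw [map_evAff, map_evAff, map_evAff] at hrep
  rcases eq_zero_or_matInj_of_bordered hrep hr with h0 | hinj
  · exact absurd h0 ht0
  · obtain ⟨B, hB1, hB2⟩ := hinj.exists_inverse (hτ := hτ)
    have hblock : ∀ (P : Matrix (Fin k) (Fin k) M.toStarSubalgebra) v u,
        matIncl hτ (Matrix.fromBlocks P v u (0 : Matrix Unit Unit M.toStarSubalgebra)) =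
          Matrix.fromBlocks (matIncl hτ P) (matIncl hτ v) (matIncl hτ u) 0 := fun P v u => by
      rw [matIncl, Matrix.fromBlocks_map, Matrix.map_zero _ (map_zero _)]; rfl
    rw [hblock] at hB1 hB2
    obtain ⟨t', h1, h2⟩ := hrep.isUnit_of_bordered hB1 hB2
    exact ⟨t', inverse_mem_ratSet ht h1 h2, h1, h2⟩

/-- If the rational closure is a division ring, then rank factorizations over it compute both
the analytic rank and the inner rank. -/
theorem rankEv_eq_innerRank [Nontrivial (Aff hτ)]
    (h : HasInverses (ratSubring (evAff hτ X).range)) {N : ℕ}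
    (P : Matrix (Fin N) (Fin N) (FreeAlgebra ℂ (Fin n))) :
    rankEv τ X P = innerRank (rationalClosure X) (evMat X P) := by
  have hP : MatIn (ratSubring (evAff hτ X).range) (P.map (evAff hτ X)) := fun i j =>
    le_ratSubring (matIn_map_evAff hτ X P i j)
  rw [rankEv_eq, rationalClosure_eq hτ, evMat_eq hτ]
  obtain ⟨B, C, -, -, hBC⟩ := exists_factorization_innerRank hP
  obtain ⟨r, B', C', L, R, hB', hC', hBC', hLR⟩ := h.exists_rank_factorization hP
  refine le_antisymm ?_ ?_
  · have := mrank_le_of_factorization hBC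
    rwa [Fintype.card_fin] at this
  · have h1 := card_le_mrank hLR
    rw [Fintype.card_fin] at h1
    refine le_trans ?_ h1
    exact_mod_cast innerRank_le_of_factorization hB' hC' hBC'

/-- If full matrices of polynomials are invertible, then every nonzero element of the rational
closure is invertible: its bordered matrix is full, since the matrix rings over the affiliated
operators are Dedekind-finite. -/
theorem hasInverses_of_full
    (h : ∀ (N : ℕ) (P : Matrix (Fin N) (Fin N) (FreeAlgebra ℂ (Fin n))),
      IsFull (rationalClosure X) (evMat X P) → ∃ Q, IsMatInverse M (evMat X P) Q) :
    HasInverses (ratSubring (evAff hτ X).range) := by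
  intro t ht ht0
  obtain ⟨k, u, P, Q, v, hrep⟩ := exists_isLinRep ht
  obtain ⟨u, rfl⟩ := hrep.row.exists_evAff
  obtain ⟨P, rfl⟩ := hrep.mat.exists_evAff
  obtain ⟨v, rfl⟩ := hrep.col.exists_evAff
  let e : Fin k ⊕ Unit ≃ Fin (k + 1) := Fintype.equivFinOfCardEq (by simp)
  let F : Matrix (Fin (k + 1)) (Fin (k + 1)) (FreeAlgebra ℂ (Fin n)) :=
    (Matrix.fromBlocks P v u 0).submatrix e.symm e.symm
  have hF : F.map (evAff hτ X) = (Matrix.fromBlocks (P.map (evAff hτ X)) (v.map (evAff hτ X))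
      (u.map (evAff hτ X)) 0).submatrix e.symm e.symm := by
    rw [← Matrix.map_zero (evAff hτ X) (map_zero _), ← Matrix.fromBlocks_map]
    rfl
  have hF' : (F.map (evAff hτ X)).submatrix e e = Matrix.fromBlocks (P.map (evAff hτ X))
      (v.map (evAff hτ X)) (u.map (evAff hτ X)) 0 := by
    rw [hF, Matrix.submatrix_submatrix]
    simp
  have hmem : MatIn (ratSubring (evAff hτ X).range) (F.map (evAff hτ X)) := fun i j =>
    le_ratSubring (matIn_map_evAff hτ X F i j)
  have hfull : IsFull (rationalClosure X) (evMat X F) := by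
    rw [IsFull, rationalClosure_eq hτ, evMat_eq hτ]
    refine le_antisymm (innerRank_le_of_factorization hmem MatIn.one (mul_one _).symm) ?_
    by_contra hlt
    rw [not_le, Nat.lt_succ_iff] at hlt
    obtain ⟨B, C, -, -, hBC⟩ := exists_factorization_innerRank hmem
    refine ht0 (hrep.eq_zero_of_factorization (B := B.submatrix e id) (C := C.submatrix id e) ?_ ?_)
    · exact hF'.symm.trans (congrArg (fun A => A.submatrix e e) hBC)
    · simpa using hlt
  obtain ⟨Q', hQ'⟩ := h _ F hfull
  obtain ⟨Q', rfl⟩ := exists_map_op_eq_of_affiliated hτ hQ'.1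
  rw [evMat_eq hτ, isMatInverse_map_op] at hQ'
  obtain ⟨t', h1, h2⟩ := hrep.isUnit_of_bordered (B := Q'.submatrix e e)
    (by rw [← hF', Matrix.submatrix_mul_equiv, hQ'.1, Matrix.submatrix_one_equiv])
    (by rw [← hF', Matrix.submatrix_mul_equiv, hQ'.2, Matrix.submatrix_one_equiv])
  exact ⟨t', inverse_mem_ratSet ht h1 h2, h1, h2⟩

/-- The rational closure and the division closure are division rings at the same time. -/
theorem hasInverses_ratSubring_iff [Nontrivial (Aff hτ)] :
    HasInverses (ratSubring (evAff hτ X).range) ↔ HasInverses (divSubring hτ X) := by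
  constructor
  · intro h d hd hd0
    obtain ⟨d', -, h1, h2⟩ := h d (divSubring_le_ratSubring hτ X hd) hd0
    exact ⟨d', inverse_mem_divSubring hτ X hd h1 h2, h1, h2⟩
  · intro h d hd hd0
    -- over a division ring, inverses of matrices do not leave the ring
    have hle : ∀ d ∈ ratSubring (evAff hτ X).range, d ∈ divSubring hτ X := by
      rintro _ ⟨k, P, Q, hP, h1, -, i, j, rfl⟩
      exact h.matIn_inverse (fun i j => range_evAff_le_divSubring hτ X (hP i j)) h1 i j
    obtain ⟨d', hd', h1, h2⟩ := h d (hle d hd) hd0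
    exact ⟨d', divSubring_le_ratSubring hτ X hd', h1, h2⟩

end Evaluation

end AtiyahProperty
end

theorem theorem1p2 {H : Type*} [NormedAddCommGroup H] [InnerProductSpace ℂ H] [CompleteSpace H]
    (M : VonNeumannAlgebra H) (τ : M.toStarSubalgebra →ₗ[ℂ] ℂ)
    (hτ : AtiyahProperty.IsTracialState M τ) (n : ℕ) (X : Fin n → M.toStarSubalgebra) :
    List.TFAE [
      AtiyahProperty.StrongAtiyah τ X,
      AtiyahProperty.IsDivisionRing M (AtiyahProperty.divisionClosure X),
      AtiyahProperty.IsDivisionRing M (AtiyahProperty.rationalClosure X),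
      ∀ (N : ℕ) (P : Matrix (Fin N) (Fin N) (FreeAlgebra ℂ (Fin n))),
        AtiyahProperty.IsFull (AtiyahProperty.rationalClosure X) (AtiyahProperty.evMat X P) →
          ∃ Q, AtiyahProperty.IsMatInverse M (AtiyahProperty.evMat X P) Q,
      ∀ (N : ℕ) (P : Matrix (Fin N) (Fin N) (FreeAlgebra ℂ (Fin n))),
        AtiyahProperty.rankEv τ X P =
          (AtiyahProperty.innerRank (AtiyahProperty.rationalClosure X)
            (AtiyahProperty.evMat X P) : ℝ)] := by
  have := AtiyahProperty.nontrivial_aff hτ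
  have h3 := AtiyahProperty.rationalClosure_eq hτ X
  tfae_have 1 → 3 := fun h => by
    rw [h3, AtiyahProperty.isDivisionRing_image_iff]
    exact h.hasInverses hτ
  tfae_have 3 → 5 := fun h N P => by
    rw [h3, AtiyahProperty.isDivisionRing_image_iff] at h
    exact AtiyahProperty.rankEv_eq_innerRank hτ X h P
  tfae_have 5 → 1 := fun h N P => ⟨_, h N P⟩
  tfae_have 5 → 4 := fun h N P hP => by
    have h1 := h N P
    rw [show AtiyahProperty.innerRank _ (AtiyahProperty.evMat X P) = N from hP,
      AtiyahProperty.rankEv_eq] at h1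
    obtain ⟨Q, hQ⟩ := (AtiyahProperty.matInj_of_mrank_eq hτ
      (by rw [h1, Fintype.card_fin])).exists_inverse (hτ := hτ)
    refine ⟨Q.map AtiyahProperty.Aff.op, ?_⟩
    rw [AtiyahProperty.evMat_eq hτ, AtiyahProperty.Aff.isMatInverse_map_op]
    exact hQ
  tfae_have 4 → 3 := fun h => by
    rw [h3, AtiyahProperty.isDivisionRing_image_iff]
    exact AtiyahProperty.hasInverses_of_full hτ X h
  tfae_have 2 ↔ 3 := by
    rw [h3, AtiyahProperty.divisionClosure_eq hτ, AtiyahProperty.isDivisionRing_image_iff,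
      AtiyahProperty.isDivisionRing_image_iff, AtiyahProperty.hasInverses_ratSubring_iff]
  tfae_finish
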